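/- Let $p\in[0,1]$ and let $(X_u)_{u\in\mathbb Z^2}$ be i.i.d. $\mathrm{Ber}(p)$ random variables on a probability space (the site percolation process on $\mathbb Z^2$ with parameter $p$); a site $u$ is open if $X_u=1$ and closed if $X_u=0$. Two sites are adjacent if their $\ell^1$-distance is $1$. The open cluster $C_u$ is the set of all sites $v$ joined to $u$ by a finite path of successively adjacent sites, all of them open, including $u$ and $v$ (so $C_u=\emptyset$ if $u$ is closed). The extended cluster is $C_u^+=C_u\cup\partial C_u$, where $\partial C_u$ is the set of closed sites adjacent to some site of $C_u$. An infinite open cluster (IOC) is an infinite set of the form $C_u$, and an infinite extended cluster (IEC) is an infinite set of the form $C_u^+$. Let $\theta(p)$ and $\theta^+(p)$ be the probabilities that the origin belongs to an IOC and to an IEC, respectively, and let $p_c$ be the critical probability, that is, the supremum of those $q\in[0,1]$ such that site percolation with parameter $q$ has almost surely no IOC. For odd $m\geq 1$ let $\Gamma_m=[-\frac{m-1}{2},\frac{m-1}{2}]^2\cap\mathbb Z^2$. Theorem. Let $p>p_c$. Then, almost surely, there is exactly one IOC $C$ and exactly one IEC $C^+$, and $$\lim_{m\to\infty}\frac{1}{m^2}\,|C\cap\Gamma_m|=\theta(p)\qquad\text{and}\qquad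 \lim_{m\to\infty}\frac{1}{m^2}\,|C^+\cap\Gamma_m|=\theta^+(p),$$ where $m$ tends to infinity through the odd integers. -/

import Mathlib

open MeasureTheory ProbabilityTheory Filter Topology

noncomputable section

namespace SitePercolation

/-- Sites of the integer lattice `ℤ²`. -/
abbrev Site : Type := ℤ × ℤ

/-- A realization of the process; `true` means open, `false` means closed. -/
abbrev Config : Type := Site → Bool

/-- The law of site percolation with parameter `p`: the product of `Ber(p)` over all sites. -/
def law (p : unitInterval) : Measure Config :=
  Measure.infinitePi fun _ : Site => bernoulliMeasure true false p

/-- Two sites are joined by an edge iff their `ℓ¹`-distance is `1`. -/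
def Adj (u v : Site) : Prop := |u.1 - v.1| + |u.2 - v.2| = 1

/-- `u` and `v` are connected by an open path `u = w 0, w 1, …, w n = v`
(all sites, including both ends, are open). -/
def OpenConnected (ω : Config) (u v : Site) : Prop :=
  ∃ (n : ℕ) (w : Fin (n + 1) → Site), w 0 = u ∧ w (Fin.last n) = v ∧
    (∀ k, ω (w k) = true) ∧ ∀ k : Fin n, Adj (w k.castSucc) (w k.succ)

/-- The open cluster `C_u`. -/
def cluster (ω : Config) (u : Site) : Set Site := {v | OpenConnected ω u v}

/-- The boundary of a set of sites: the closed sites that are adjacent to it. -/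
def boundary (ω : Config) (S : Set Site) : Set Site :=
  {v | ω v = false ∧ ∃ w ∈ S, Adj v w}

/-- The extended cluster `C_u⁺ = C_u ∪ ∂C_u` (empty if `u` is closed). -/
def extCluster (ω : Config) (u : Site) : Set Site :=
  cluster ω u ∪ boundary ω (cluster ω u)

/-- `C` is an infinite open cluster. -/
def IsIOC (ω : Config) (C : Set Site) : Prop := C.Infinite ∧ ∃ u, C = cluster ω u

/-- `C` is an infinite extended cluster. -/
def IsIEC (ω : Config) (C : Set Site) : Prop := C.Infinite ∧ ∃ u, C = extCluster ω u

/-- The percolation probability: the origin is in an infinite open cluster. -/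
def theta (p : unitInterval) : ℝ :=
  (law p).real {ω | ∃ C, IsIOC ω C ∧ (0 : Site) ∈ C}

/-- The probability that the origin is in an infinite extended cluster. -/
def thetaPlus (p : unitInterval) : ℝ :=
  (law p).real {ω | ∃ C, IsIEC ω C ∧ (0 : Site) ∈ C}

/-- The critical probability: the supremum of the parameters in `[0, 1]` (among them `0`)
at which there is almost surely no infinite open cluster. -/
def pc : ℝ :=
  sSup ((fun p : unitInterval => (p : ℝ)) '' {p | ∀ᵐ ω ∂(law p), ¬ ∃ C, IsIOC ω C})

/-- The grid `Γ_m = [-(m-1)/2, (m-1)/2]² ∩ ℤ²`. -/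
def grid (m : ℕ) : Set Site :=
  {u | |(u.1 : ℝ)| ≤ ((m : ℝ) - 1) / 2 ∧ |(u.2 : ℝ)| ≤ ((m : ℝ) - 1) / 2}

/-- `X` is a site percolation process with parameter `p` on the probability space `(Ω, μ)`:
independent `Ber(p)` variables indexed by the sites. -/
structure IsProcess {Ω : Type*} [MeasurableSpace Ω] (μ : Measure Ω) (p : unitInterval)
    (X : Site → Ω → Bool) : Prop where
  measurable : ∀ u, Measurable (X u)
  indep : iIndepFun X μ
  map_eq : ∀ u, μ.map (X u) = bernoulliMeasure true false p

end SitePercolation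

end

/-! Independence identifies the law of the process with a product measure, which is invariant and
ergodic under every nonzero translation of the lattice. Three consequences of ergodicity carry the
proof.

Existence: having an infinite cluster is a translation-invariant event, hence has probability 0 or
1, and probability 0 would make `p` a competitor in the supremum defining `pc`.

Uniqueness is the Burton-Keane argument. If three infinite clusters met a box with positive
probability, opening that box would produce a trifurcation box with positive probability. Disjoint
trifurcation boxes form a forest-like structure with at most as many branching boxes as end points
on a surrounding sphere (`IsBranchSystem.card_le_card`). In a large square the expected number of
such boxes would grow like the area, while the bound grows like the perimeter. So there are at most
two infinite clusters; some box meets all of them, and opening it merges them. By the zero-one law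
there is then almost surely at most one.

Density: given uniqueness, belonging to the infinite (extended) cluster is a translation-covariant
property of a site. Its frequency in large squares is governed by a pointwise ergodic theorem over
squares, derived from Birkhoff's theorem in each coordinate direction (`ae_tendsto_squareAverage`).
-/

namespace ErgodicTheory

/-! ### Maximal ergodic inequality and Birkhoff's theorem -/

variable {α : Type*} {T : α → α} {g : α → ℝ}

/-- The maximum of the first `n + 1` Birkhoff sums (including the empty one). -/
def maxBirkhoffSum (T : α → α) (g : α → ℝ) : ℕ → α → ℝ
  | 0 => fun _ => 0
  | n + 1 => fun x => max 0 (g x + maxBirkhoffSum T g n (T x))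

theorem maxBirkhoffSum_nonneg (n : ℕ) (x : α) : 0 ≤ maxBirkhoffSum T g n x := by
  cases n with
  | zero => exact le_rfl
  | succ n => exact le_max_left _ _

theorem maxBirkhoffSum_le_succ (n : ℕ) (x : α) :
    maxBirkhoffSum T g n x ≤ maxBirkhoffSum T g (n + 1) x := by
  induction n generalizing x with
  | zero => exact le_max_left _ _
  | succ n ih =>
    simp only [maxBirkhoffSum] at ih ⊢
    exact max_le_max le_rfl (add_le_add le_rfl (ih (T x)))

theorem birkhoffSum_le_maxBirkhoffSum (n : ℕ) (x : α) :
    birkhoffSum T g n x ≤ maxBirkhoffSum T g n x := by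
  induction n generalizing x with
  | zero => simp [maxBirkhoffSum]
  | succ n ih =>
    rw [birkhoffSum_succ']
    exact (add_le_add le_rfl (ih (T x))).trans (le_max_right _ _)

theorem birkhoffSum_sub_const (f : α → ℝ) (a : ℝ) (n : ℕ) (x : α) :
    birkhoffSum T (fun y => f y - a) n x = birkhoffSum T f n x - n * a := by
  simp [birkhoffSum]

variable [MeasurableSpace α] {μ : Measure α}

theorem measurable_maxBirkhoffSum (hT : Measurable T) (hg : Measurable g) (n : ℕ) :
    Measurable (maxBirkhoffSum T g n) := by
  induction n with
  | zero => exact measurable_const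
  | succ n ih => exact measurable_const.max (hg.add (ih.comp hT))

theorem integrable_maxBirkhoffSum (hT : MeasurePreserving T μ μ) (hg : Integrable g μ) (n : ℕ) :
    Integrable (maxBirkhoffSum T g n) μ := by
  induction n with
  | zero => exact integrable_zero _ _ _
  | succ n ih =>
    exact (integrable_zero α ℝ μ).sup (hg.add (hT.integrable_comp_of_integrable ih))

/-- The maximal ergodic inequality. -/
theorem setIntegral_maxBirkhoffSum_pos_nonneg (hT : MeasurePreserving T μ μ) (hgm : Measurable g)
    (hg : Integrable g μ) (n : ℕ) :
    0 ≤ ∫ x in {x | 0 < maxBirkhoffSum T g n x}, g x ∂μ := by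
  cases n with
  | zero => simp [maxBirkhoffSum]
  | succ n =>
    set s := {x | 0 < maxBirkhoffSum T g (n + 1) x} with hs
    have hsm : MeasurableSet s :=
      measurableSet_lt measurable_const (measurable_maxBirkhoffSum hT.measurable hgm _)
    have hM := integrable_maxBirkhoffSum hT hg
    have hMT : Integrable (fun x => maxBirkhoffSum T g n (T x)) μ :=
      hT.integrable_comp_of_integrable (hM n)
    -- Where the maximum is positive it is attained by its second argument, so `g` is the difference
    -- of `M (n + 1)` and `M n ∘ T` there. Passing from `s` to the whole space keeps the first
    -- integral and can only increase the second, which by invariance is at most the first.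
    have h1 : ∫ x in s, g x ∂μ =
        ∫ x in s, maxBirkhoffSum T g (n + 1) x ∂μ - ∫ x in s, maxBirkhoffSum T g n (T x) ∂μ := by
      rw [← integral_sub (hM (n + 1)).integrableOn hMT.integrableOn]
      refine setIntegral_congr_fun hsm fun x hx => ?_
      have hx' : 0 < max 0 (g x + maxBirkhoffSum T g n (T x)) := hx
      have : 0 < g x + maxBirkhoffSum T g n (T x) := by
        rcases lt_max_iff.1 hx' with h | h
        · exact absurd h (lt_irrefl _)
        · exact h
      simp only [maxBirkhoffSum, max_eq_right this.le]
      ring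
    have h2 : ∫ x in s, maxBirkhoffSum T g (n + 1) x ∂μ = ∫ x, maxBirkhoffSum T g (n + 1) x ∂μ := by
      refine setIntegral_eq_integral_of_forall_compl_eq_zero fun x hx => ?_
      exact le_antisymm (not_lt.1 hx) (maxBirkhoffSum_nonneg _ _)
    have h3 : ∫ x in s, maxBirkhoffSum T g n (T x) ∂μ ≤ ∫ x, maxBirkhoffSum T g n x ∂μ := by
      calc _ ≤ ∫ x, maxBirkhoffSum T g n (T x) ∂μ :=
            setIntegral_le_integral hMT (Eventually.of_forall fun x => maxBirkhoffSum_nonneg _ _)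
        _ = ∫ x, maxBirkhoffSum T g n x ∂μ := by
            have h := integral_map (μ := μ) hT.measurable.aemeasurable
              (f := maxBirkhoffSum T g n) (by rw [hT.map_eq]; exact (hM n).aestronglyMeasurable)
            rw [hT.map_eq] at h
            exact h.symm
    have h4 : ∫ x, maxBirkhoffSum T g n x ∂μ ≤ ∫ x, maxBirkhoffSum T g (n + 1) x ∂μ :=
      integral_mono (hM n) (hM (n + 1)) fun x => maxBirkhoffSum_le_succ n x
    linarith

theorem measurable_birkhoffSum (hT : Measurable T) (hg : Measurable g) (n : ℕ) :
    Measurable (birkhoffSum T g n) :=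
  Finset.measurable_fun_sum _ fun k _ => hg.comp (hT.iterate k)

/-- The set where the sums are unbounded above is invariant, so it is null or conull. If conull,
almost every point has some positive maximum, and the maximal inequality passes to the limit `0 ≤ ∫
g`, a contradiction. -/
theorem ae_bddAbove_birkhoffSum (hT : Ergodic T μ) (hgm : Measurable g)
    (hg : Integrable g μ) (hneg : ∫ x, g x ∂μ < 0) :
    ∀ᵐ x ∂μ, ∃ c : ℕ, ∀ n, birkhoffSum T g n x ≤ c := by
  set B : Set α := {x | ∀ c : ℕ, ∃ n, (c : ℝ) < birkhoffSum T g n x} with hB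
  have hBm : MeasurableSet B := by
    have : B = ⋂ c : ℕ, ⋃ n, {x | (c : ℝ) < birkhoffSum T g n x} := by ext; simp [hB]
    rw [this]
    exact .iInter fun c => .iUnion fun n =>
      measurableSet_lt measurable_const (measurable_birkhoffSum hT.measurable hgm n)
  have hinv : T ⁻¹' B = B := by
    ext x
    constructor
    · intro h c
      obtain ⟨d, hd⟩ := exists_nat_gt ((c : ℝ) - g x)
      obtain ⟨n, hn⟩ := h d
      exact ⟨n + 1, by rw [birkhoffSum_succ']; linarith⟩
    · intro h c
      obtain ⟨d, hd⟩ := exists_nat_gt (max 0 ((c : ℝ) + g x))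
      obtain ⟨n, hn⟩ := h d
      cases n with
      | zero =>
        rw [birkhoffSum_zero] at hn
        exact absurd hn (not_lt.2 (Nat.cast_nonneg d))
      | succ n =>
        rw [birkhoffSum_succ'] at hn
        exact ⟨n, by linarith [le_max_right 0 ((c : ℝ) + g x)]⟩
  rcases hT.toPreErgodic.ae_mem_or_ae_notMem hBm hinv with h | h
  · exfalso
    set s : ℕ → Set α := fun n => {x | 0 < maxBirkhoffSum T g n x} with hs
    have hsm : ∀ n, MeasurableSet (s n) := fun n =>
      measurableSet_lt measurable_const (measurable_maxBirkhoffSum hT.measurable hgm _)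
    have hmono : Monotone s := monotone_nat_of_le_succ fun n x hx =>
      lt_of_lt_of_le hx (maxBirkhoffSum_le_succ n x)
    have hlim := tendsto_setIntegral_of_monotone (μ := μ) (f := g) hsm hmono hg.integrableOn
    have hge : 0 ≤ ∫ x in ⋃ n, s n, g x ∂μ := ge_of_tendsto' hlim fun n =>
      setIntegral_maxBirkhoffSum_pos_nonneg hT.toMeasurePreserving hgm hg n
    have huniv : (⋃ n, s n) =ᵐ[μ] (Set.univ : Set α) := by
      rw [eventuallyEq_univ]
      filter_upwards [h] with x hx
      obtain ⟨n, hn⟩ := hx 0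
      refine Set.mem_iUnion.2 ⟨n, lt_of_lt_of_le ?_ (birkhoffSum_le_maxBirkhoffSum n x)⟩
      simpa using hn
    rw [setIntegral_congr_set huniv, setIntegral_univ] at hge
    linarith
  · filter_upwards [h] with x hx
    simpa [hB] using hx

/-- For `b` strictly between `∫ g` and `a`, the sums of `g - b` are bounded by some `c`, so the
averages of `g` are at most `b + c / n`. -/
theorem ae_eventually_birkhoffSum_div_lt [IsProbabilityMeasure μ] (hT : Ergodic T μ)
    (hgm : Measurable g) (hg : Integrable g μ) {a : ℝ} (ha : ∫ x, g x ∂μ < a) :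
    ∀ᵐ x ∂μ, ∀ᶠ n : ℕ in atTop, birkhoffSum T g n x / n < a := by
  obtain ⟨b, hb, hba⟩ := exists_between ha
  have h := ae_bddAbove_birkhoffSum hT (g := fun x => g x - b) (hgm.sub_const b)
    (hg.sub (integrable_const b)) (by
      rw [integral_sub hg (integrable_const b)]
      simpa using hb)
  filter_upwards [h] with x ⟨c, hc⟩
  have hlim : Tendsto (fun n : ℕ => (c : ℝ) / n) atTop (𝓝 0) :=
    tendsto_const_div_atTop_nhds_zero_nat _
  filter_upwards [hlim.eventually_lt_const (sub_pos.2 hba), eventually_gt_atTop 0] with n hn hn0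
  have hn0' : (0 : ℝ) < n := by exact_mod_cast hn0
  have := hc n
  rw [birkhoffSum_sub_const] at this
  rw [div_lt_iff₀ hn0'] at hn ⊢
  nlinarith

/-- **Birkhoff's pointwise ergodic theorem** for an ergodic map. -/
theorem ae_tendsto_birkhoffSum_div [IsProbabilityMeasure μ] (hT : Ergodic T μ)
    (hgm : Measurable g) (hg : Integrable g μ) :
    ∀ᵐ x ∂μ, Tendsto (fun n : ℕ => birkhoffSum T g n x / n) atTop (𝓝 (∫ x, g x ∂μ)) := by
  have h1 : ∀ᵐ x ∂μ, ∀ k : ℕ, ∀ᶠ n : ℕ in atTop,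
      birkhoffSum T g n x / n < ∫ x, g x ∂μ + 1 / ((k : ℝ) + 1) :=
    ae_all_iff.2 fun k => ae_eventually_birkhoffSum_div_lt hT hgm hg
      (lt_add_of_pos_right _ Nat.one_div_pos_of_nat)
  have h2 : ∀ᵐ x ∂μ, ∀ k : ℕ, ∀ᶠ n : ℕ in atTop,
      birkhoffSum T (-g) n x / n < -∫ x, g x ∂μ + 1 / ((k : ℝ) + 1) :=
    ae_all_iff.2 fun k => ae_eventually_birkhoffSum_div_lt hT hgm.neg hg.neg (by
      rw [integral_neg']
      exact lt_add_of_pos_right _ Nat.one_div_pos_of_nat)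
  filter_upwards [h1, h2] with x hx1 hx2
  refine Metric.tendsto_nhds.2 fun ε hε => ?_
  obtain ⟨k, hk⟩ := exists_nat_one_div_lt hε
  filter_upwards [hx1 k, hx2 k] with n hn1 hn2
  rw [birkhoffSum_neg, neg_div] at hn2
  rw [Real.dist_eq, abs_lt]
  constructor <;> linarith

end ErgodicTheory

/-! ### Ergodicity of translations -/

namespace SitePercolation

instance isProbabilityMeasure_law (p : unitInterval) : IsProbabilityMeasure (law p) := by
  unfold law; infer_instance

/-- Translation of configurations. -/
def shift (z : Site) (ω : Config) : Config := fun u => ω (u + z)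

theorem shift_shift (y z : Site) (ω : Config) : shift y (shift z ω) = shift (y + z) ω := by
  funext u; simp [shift, add_assoc]

theorem shift_zero (ω : Config) : shift 0 ω = ω := by funext u; simp [shift]

theorem iterate_shift (z : Site) (n : ℕ) : (shift z)^[n] = shift (n • z) := by
  induction n with
  | zero => funext ω; simp [shift_zero]
  | succ n ih => funext ω; rw [Function.iterate_succ_apply, ih, shift_shift, succ_nsmul]

theorem measurable_shift (z : Site) : Measurable (shift z) :=
  measurable_pi_lambda _ fun u => measurable_pi_apply (u + z)

theorem measurePreserving_shift (p : unitInterval) (z : Site) :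
    MeasurePreserving (shift z) (law p) (law p) :=
  ⟨measurable_shift z, Measure.map_infinitePi_infinitePi_of_inj
    (P := fun _ : Site => bernoulliMeasure true false p) (add_left_injective z)⟩

theorem iIndepFun_eval_law (p : unitInterval) :
    iIndepFun (fun (u : Site) (ω : Config) => ω u) (law p) :=
  iIndepFun_infinitePi (X := fun _ (b : Bool) => b) fun _ => measurable_id

theorem isSetAlgebra_measurableCylinders : IsSetAlgebra (measurableCylinders fun _ : Site => Bool) where
  empty_mem := empty_mem_measurableCylinders _
  compl_mem _ h := compl_mem_measurableCylinders h
  union_mem _ _ hs ht := union_mem_measurableCylinders hs ht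

/-- A common point makes `n • z` a difference of two points of `I`. There are finitely many
differences but infinitely many multiples of `z`. -/
theorem exists_disjoint_translate (I : Finset Site) {z : Site} (hz : z ≠ 0) :
    ∃ n : ℕ, Disjoint I (I.map (addRightEmbedding (n • z))) := by
  have hinj : Function.Injective fun n : ℕ => n • z := by
    intro m n h
    have h' : ((m : ℤ) - n) • z = 0 := by
      rw [sub_smul, natCast_zsmul, natCast_zsmul]; exact sub_eq_zero.2 h
    rcases smul_eq_zero.1 h' with h | h
    · omega
    · exact absurd h hz
  obtain ⟨_, ⟨n, rfl⟩, hn⟩ :=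
    (Set.infinite_range_of_injective hinj).exists_notMem_finset
      ((I ×ˢ I).image fun q => q.1 - q.2)
  refine ⟨n, Finset.disjoint_left.2 fun x hx hx' => hn ?_⟩
  obtain ⟨y, hy, rfl⟩ := Finset.mem_map.1 hx'
  refine Finset.mem_image.2 ⟨(_, y), Finset.mem_product.2 ⟨hx, hy⟩, ?_⟩
  simp

/-- The two cylinders depend on disjoint sets of coordinates, hence are independent, and they have
equal probability. -/
theorem measure_cylinder_inter_translate (p : unitInterval) (I : Finset Site)
    {S : Set (I → Bool)} (hS : MeasurableSet S) {z : Site}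
    (hz : Disjoint I (I.map (addRightEmbedding z))) :
    (law p).real (cylinder (α := fun _ : Site => Bool) I S ∩
      shift z ⁻¹' (cylinder (α := fun _ : Site => Bool) I S)) =
      (law p).real (cylinder (α := fun _ : Site => Bool) I S) ^ 2 := by
  set t : Set Config := cylinder (α := fun _ : Site => Bool) I S with ht
  have htm : MeasurableSet t := hS.cylinder
  have hind := (iIndepFun_eval_law p).indepFun_finset I (I.map (addRightEmbedding z)) hz
    fun i => measurable_pi_apply i
  set φ : ((I.map (addRightEmbedding z) : Finset Site) → Bool) → (I → Bool) :=
    fun f i => f ⟨i + z, Finset.mem_map.2 ⟨i, i.2, rfl⟩⟩ with hφ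
  have hφm : Measurable φ := measurable_pi_lambda _ fun i => measurable_pi_apply _
  have h := hind.measure_inter_preimage_eq_mul S (φ ⁻¹' S) hS (hφm hS)
  have h2 : (law p) (shift z ⁻¹' t) = law p t :=
    (measurePreserving_shift p z).measure_preimage htm.nullMeasurableSet
  have h' : law p (t ∩ shift z ⁻¹' t) = law p t * law p (shift z ⁻¹' t) := h
  rw [h2] at h'
  simp only [measureReal_def, h', ENNReal.toReal_mul, sq]

/-- An invariant event is close both to a cylinder and to its far translate, hence to their
intersection, whose probability is a square. Thus its probability satisfies `a = a ^ 2`. -/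
theorem ergodic_shift (p : unitInterval) {z : Site} (hz : z ≠ 0) :
    Ergodic (shift z) (law p) where
  toMeasurePreserving := measurePreserving_shift p z
  aeconst_set := by
    intro A hA hinv
    have hdense := Measure.MeasureDense.of_generateFrom_isSetAlgebra_finite (law p)
      isSetAlgebra_measurableCylinders generateFrom_measurableCylinders.symm
    -- Replacing `A` by the intersection costs `2 * ε`, and comparing the squares of two numbers in
    -- `[0, 1]` at distance `ε` costs another `2 * ε`; the factor 5 leaves slack.
    have key : ∀ ε : ℝ, 0 < ε → |(law p).real A - (law p).real A ^ 2| ≤ 5 * ε := by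
      intro ε hε
      obtain ⟨t, ht, hAt⟩ := hdense.approx A hA (measure_ne_top _ _) ε hε
      obtain ⟨I, S, hS, rfl⟩ := (mem_measurableCylinders t).1 ht
      obtain ⟨n, hn⟩ := exists_disjoint_translate I hz
      set t : Set Config := cylinder (α := fun _ : Site => Bool) I S with htdef
      have htm : MeasurableSet t := hS.cylinder
      set z' := n • z
      have hinv' : shift z' ⁻¹' A = A := by
        have : ∀ k : ℕ, (shift z)^[k] ⁻¹' A = A := by
          intro k
          induction k with
          | zero => rfl
          | succ k ih => rw [Function.iterate_succ', Set.preimage_comp, hinv, ih]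
        rw [← iterate_shift]; exact this n
      have hAt' : (law p).real (symmDiff A t) ≤ ε :=
        ENNReal.toReal_le_of_le_ofReal hε.le hAt.le
      have hAt'' : (law p).real (symmDiff A (shift z' ⁻¹' t)) ≤ ε := by
        have : symmDiff A (shift z' ⁻¹' t) = shift z' ⁻¹' (symmDiff A t) := by
          conv_lhs => rw [← hinv']
          rfl
        rw [this, measureReal_def, (measurePreserving_shift p z').measure_preimage
          (hA.symmDiff htm).nullMeasurableSet]
        exact hAt'
      have hsub : symmDiff A (t ∩ shift z' ⁻¹' t) ⊆
          symmDiff A t ∪ symmDiff A (shift z' ⁻¹' t) := by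
        intro x
        simp only [Set.mem_symmDiff, Set.mem_inter_iff, Set.mem_union]
        tauto
      have h1 : |(law p).real A - (law p).real (t ∩ shift z' ⁻¹' t)| ≤ 2 * ε := by
        calc _ ≤ (law p).real (symmDiff A (t ∩ shift z' ⁻¹' t)) :=
              abs_measureReal_sub_le_measureReal_symmDiff hA.nullMeasurableSet
                (htm.inter (measurable_shift z' htm)).nullMeasurableSet
          _ ≤ _ := measureReal_mono hsub
          _ ≤ _ := measureReal_union_le _ _
          _ ≤ 2 * ε := by linarith
      have h2 : |(law p).real A - (law p).real t| ≤ ε :=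
        (abs_measureReal_sub_le_measureReal_symmDiff hA.nullMeasurableSet
          htm.nullMeasurableSet).trans hAt'
      rw [measure_cylinder_inter_translate p I hS hn, ← htdef] at h1
      have ha0 : 0 ≤ (law p).real A := measureReal_nonneg
      have ha1 : (law p).real A ≤ 1 := measureReal_le_one
      have ht0 : 0 ≤ (law p).real t := measureReal_nonneg
      have ht1 : (law p).real t ≤ 1 := measureReal_le_one
      rw [abs_le] at h1 h2 ⊢
      constructor <;> nlinarith
    have hzero : (law p).real A - (law p).real A ^ 2 = 0 := by
      by_contra h
      have hpos := abs_pos.2 h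
      have := key (|(law p).real A - (law p).real A ^ 2| / 10) (by positivity)
      linarith
    have hcase : (law p).real A = 0 ∨ (law p).real A = 1 := by
      have : (law p).real A * (1 - (law p).real A) = 0 := by linarith
      rcases mul_eq_zero.1 this with h | h
      · exact Or.inl h
      · exact Or.inr (by linarith)
    rw [eventuallyConst_set']
    rcases hcase with h | h
    · left
      rw [measureReal_eq_zero_iff] at h
      exact ae_eq_empty.2 h
    · right
      rw [measureReal_def, ENNReal.toReal_eq_one_iff] at h
      rw [eventuallyEq_univ]
      exact (mem_ae_iff_prob_eq_one hA).2 h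

/-! ### Averages over lines and squares -/

/-- The average of `f` over the translates by `i • z` with `|i| ≤ k`. -/
noncomputable def lineAverage (z : Site) (f : Config → ℝ) (k : ℕ) (ω : Config) : ℝ :=
  (∑ i ∈ Finset.Icc (-k : ℤ) k, f (shift (i • z) ω)) / (2 * k + 1)

theorem sum_Icc_neg_self (F : ℤ → ℝ) (k : ℕ) :
    ∑ i ∈ Finset.Icc (-k : ℤ) k, F i =
      ∑ i ∈ Finset.range (k + 1), F i + ∑ i ∈ Finset.range (k + 1), F (-i) - F 0 := by
  induction k with
  | zero => simp
  | succ k ih =>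
    have h : Finset.Icc (-(k + 1 : ℕ) : ℤ) (k + 1 : ℕ) =
        insert ((k + 1 : ℕ) : ℤ) (insert (-(k + 1 : ℕ) : ℤ) (Finset.Icc (-k : ℤ) k)) := by
      ext i; simp only [Finset.mem_Icc, Finset.mem_insert]; omega
    rw [h, Finset.sum_insert (by simp only [Finset.mem_Icc, Finset.mem_insert]; omega),
      Finset.sum_insert (by simp only [Finset.mem_Icc]; omega), ih,
      Finset.sum_range_succ _ (k + 1), Finset.sum_range_succ _ (k + 1)]
    ring

theorem measurable_lineAverage (z : Site) {f : Config → ℝ} (hf : Measurable f) (k : ℕ) :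
    Measurable (lineAverage z f k) :=
  (Finset.measurable_fun_sum _ fun i _ => hf.comp (measurable_shift (i • z))).div_const _

theorem ae_tendsto_lineAverage (p : unitInterval) {z : Site} (hz : z ≠ 0) {f : Config → ℝ}
    (hfm : Measurable f) (hf : Integrable f (law p)) :
    ∀ᵐ ω ∂law p, Tendsto (fun k => lineAverage z f k ω) atTop (𝓝 (∫ ω, f ω ∂law p)) := by
  filter_upwards [ErgodicTheory.ae_tendsto_birkhoffSum_div (ergodic_shift p hz) hfm hf,
    ErgodicTheory.ae_tendsto_birkhoffSum_div (ergodic_shift p (neg_ne_zero.2 hz)) hfm hf]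
    with ω h1 h2
  -- Each of the two one-sided sums has `k + 1` of the `2 * k + 1` terms, so it gets weight 1/2 in
  -- the limit; the doubly counted central term is negligible.
  have hr : Tendsto (fun k : ℕ => ((k : ℝ) + 1) / (2 * k + 1)) atTop (𝓝 (1 / 2)) := by
    have h : Tendsto (fun k : ℕ => (1 / 2 : ℝ) + (1 / 2) * (1 / (2 * (k : ℝ) + 1))) atTop
        (𝓝 (1 / 2 + (1 / 2) * 0)) := by
      refine tendsto_const_nhds.add (Tendsto.const_mul _ ?_)
      refine tendsto_const_nhds.div_atTop ?_
      exact tendsto_atTop_add_const_right _ _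
        (tendsto_natCast_atTop_atTop.const_mul_atTop (by norm_num))
    rw [mul_zero, add_zero] at h
    refine h.congr fun k => ?_
    field_simp
    ring
  have h0 : Tendsto (fun k : ℕ => f ω / (2 * (k : ℝ) + 1)) atTop (𝓝 0) :=
    tendsto_const_nhds.div_atTop (tendsto_atTop_add_const_right _ _
        (tendsto_natCast_atTop_atTop.const_mul_atTop (by norm_num)))
  have h1' := (h1.comp (tendsto_add_atTop_nat 1)).mul hr
  have h2' := (h2.comp (tendsto_add_atTop_nat 1)).mul hr
  have h := (h1'.add h2').sub h0
  have hlim : (∫ ω, f ω ∂law p) * (1 / 2) + (∫ ω, f ω ∂law p) * (1 / 2) - 0 =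
      ∫ ω, f ω ∂law p := by ring
  rw [hlim] at h
  refine h.congr fun k => ?_
  have e1 : ∀ i : ℕ, f ((shift z)^[i] ω) = f (shift ((i : ℤ) • z) ω) := fun i => by
    rw [iterate_shift, natCast_zsmul]
  have e2 : ∀ i : ℕ, f ((shift (-z))^[i] ω) = f (shift ((-i : ℤ) • z) ω) := fun i => by
    rw [iterate_shift, neg_smul, natCast_zsmul, smul_neg]
  simp only [lineAverage, sum_Icc_neg_self, Function.comp, birkhoffSum, e1, e2, zero_smul,
    shift_zero]
  push_cast
  field_simp

/-- The average of `f` over the translates in the square of radius `k`. -/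
noncomputable def squareAverage (f : Config → ℝ) (k : ℕ) (ω : Config) : ℝ :=
  lineAverage (0, 1) (lineAverage (1, 0) f k) k ω

theorem lineAverage_mono {z : Site} {f g : Config → ℝ} (h : ∀ ω, f ω ≤ g ω) (k : ℕ)
    (ω : Config) : lineAverage z f k ω ≤ lineAverage z g k ω :=
  div_le_div_of_nonneg_right (Finset.sum_le_sum fun _ _ => h _) (by positivity)

theorem card_Icc_neg_self (k : ℕ) : ((Finset.Icc (-k : ℤ) k).card : ℝ) = 2 * k + 1 := by
  rw [Int.card_Icc]
  have : ((k : ℤ) + 1 - -k).toNat = 2 * k + 1 := by omega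
  rw [this]; push_cast; ring

theorem lineAverage_affine (z : Site) (f : Config → ℝ) (a b : ℝ) (k : ℕ) (ω : Config) :
    lineAverage z (fun η => a + b * f η) k ω = a + b * lineAverage z f k ω := by
  simp only [lineAverage, Finset.sum_add_distrib, ← Finset.mul_sum, Finset.sum_const,
    nsmul_eq_mul, card_Icc_neg_self]
  field_simp

theorem lineAverage_mem_Icc {z : Site} {f : Config → ℝ} (h : ∀ ω, f ω ∈ Set.Icc (0 : ℝ) 1)
    (k : ℕ) (ω : Config) : lineAverage z f k ω ∈ Set.Icc (0 : ℝ) 1 := by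
  have e := lineAverage_affine z f 0 0 k ω
  have e' := lineAverage_affine z f 1 0 k ω
  have l := lineAverage_mono (z := z) (f := fun η => 0 + 0 * f η) (g := f)
    (fun η => by simpa using (h η).1) k ω
  have r := lineAverage_mono (z := z) (f := f) (g := fun η => 1 + 0 * f η)
    (fun η => by simpa using (h η).2) k ω
  constructor <;> linarith

/-- The pointwise ergodic theorem over squares for functions with values in `[0, 1]`. -/
theorem ae_tendsto_squareAverage (p : unitInterval) {f : Config → ℝ}
    (hfm : Measurable f) (hf : ∀ ω, f ω ∈ Set.Icc (0 : ℝ) 1) :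
    ∀ᵐ ω ∂law p, Tendsto (fun k => squareAverage f k ω) atTop (𝓝 (∫ ω, f ω ∂law p)) := by
  set m := ∫ ω, f ω ∂law p with hm
  have hint : Integrable f (law p) :=
    Integrable.of_mem_Icc 0 1 hfm.aemeasurable (Eventually.of_forall hf)
  have hm01 : m ∈ Set.Icc (0 : ℝ) 1 := by
    constructor
    · exact integral_nonneg fun ω => (hf ω).1
    · calc m ≤ ∫ _, (1 : ℝ) ∂law p := integral_mono hint (integrable_const _) fun ω => (hf ω).2
        _ = 1 := by simp
  have hline := ae_tendsto_lineAverage p (z := (1, 0)) (by simp) hfm hint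
  have hstep : ∀ l : ℕ, ∀ᵐ ω ∂law p, ∀ᶠ k in atTop,
      |squareAverage f k ω - m| < 3 * (1 / ((l : ℝ) + 1)) := by
    intro l
    set ε : ℝ := 1 / ((l : ℝ) + 1) with hε
    have hεpos : 0 < ε := Nat.one_div_pos_of_nat
    -- Egorov: off a set `t` of measure at most `ε` the horizontal averages are uniformly within `ε`
    -- of `m`, and on `t` the error is at most 1. The vertical averages of the indicator of `t` are
    -- eventually below `2 * ε`, for a total of `3 * ε`.
    obtain ⟨t, htm, htε, hunif⟩ := tendstoUniformlyOn_of_ae_tendsto'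
      (fun k => (measurable_lineAverage (1, 0) hfm k).stronglyMeasurable)
      (stronglyMeasurable_const (b := m)) hline hεpos
    have hindm : Measurable (t.indicator fun _ => (1 : ℝ)) := measurable_const.indicator htm
    have hI : ∫ ω, t.indicator (fun _ => (1 : ℝ)) ω ∂law p < 2 * ε := by
      have : ∫ ω, t.indicator (fun _ => (1 : ℝ)) ω ∂law p = (law p).real t :=
        integral_indicator_one htm
      rw [this]
      have : (law p).real t ≤ ε := ENNReal.toReal_le_of_le_ofReal hεpos.le htε
      linarith
    filter_upwards [ae_tendsto_lineAverage p (z := (0, 1)) (by simp) hindm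
      ((integrable_const 1).indicator htm)] with ω hω
    filter_upwards [hω.eventually_lt_const hI, Metric.tendstoUniformlyOn_iff.1 hunif ε hεpos]
      with k hk1 hk2
    have hbound : ∀ η, |lineAverage (1, 0) f k η - m| ≤ ε + t.indicator (fun _ => (1 : ℝ)) η := by
      intro η
      by_cases hη : η ∈ t
      · rw [Set.indicator_of_mem hη]
        have := lineAverage_mem_Icc (z := (1, 0)) hf k η
        rw [abs_le]
        constructor <;> linarith [this.1, this.2, hm01.1, hm01.2]
      · rw [Set.indicator_of_notMem hη, add_zero, ← Real.dist_eq, dist_comm]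
        exact (hk2 η hη).le
    have hup := lineAverage_mono (z := (0, 1)) (f := lineAverage (1, 0) f k)
      (g := fun η => (m + ε) + 1 * t.indicator (fun _ => (1 : ℝ)) η)
      (fun η => by linarith [(abs_le.1 (hbound η)).2]) k ω
    have hlo := lineAverage_mono (z := (0, 1))
      (f := fun η => (m - ε) + (-1) * t.indicator (fun _ => (1 : ℝ)) η)
      (g := lineAverage (1, 0) f k)
      (fun η => by linarith [(abs_le.1 (hbound η)).1]) k ω
    rw [lineAverage_affine] at hup hlo
    rw [squareAverage, abs_lt]
    constructor <;> linarith
  filter_upwards [ae_all_iff.2 hstep] with ω hω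
  refine Metric.tendsto_nhds.2 fun ε hε => ?_
  obtain ⟨l, hl⟩ := exists_nat_one_div_lt (show 0 < ε / 3 by positivity)
  filter_upwards [hω l] with k hk
  rw [Real.dist_eq]
  linarith

theorem squareAverage_eq_sum (f : Config → ℝ) (k : ℕ) (ω : Config) :
    squareAverage f k ω = (∑ u ∈ Finset.Icc (-k : ℤ) k ×ˢ Finset.Icc (-k : ℤ) k,
      f (shift u ω)) / (2 * k + 1) ^ 2 := by
  simp only [squareAverage, lineAverage, shift_shift, ← Finset.sum_div, Finset.sum_product_right,
    div_div, sq]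
  simp

/-! ### Combinatorics of branching -/

/-- A system of branches: every index `s ∈ I` carries a set `B s` and a family `F s` of branches
emanating from it, nested as the components of the complements of disjoint connected sets are. -/
structure IsBranchSystem {ι V : Type*} (I : Set ι) (B : ι → Set V) (F : ι → Set (Set V)) :
    Prop where
  nonempty : ∀ s ∈ I, (B s).Nonempty
  disjoint_self : ∀ s ∈ I, ∀ D ∈ F s, Disjoint D (B s)
  disjoint : ∀ s ∈ I, ∀ D ∈ F s, ∀ E ∈ F s, D ≠ E → Disjoint D E
  subset_or_disjoint : ∀ s ∈ I, ∀ t ∈ I, s ≠ t → ∀ E ∈ F t, B s ⊆ E ∨ Disjoint E (B s)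
  subset_of_subset : ∀ s ∈ I, ∀ t ∈ I, s ≠ t → ∀ E ∈ F t, B s ⊆ E →
    ∀ D ∈ F s, Disjoint D (B t) → D ⊆ E
  union_subset_or_disjoint : ∀ s ∈ I, ∀ t ∈ I, s ≠ t → ∀ E ∈ F t, Disjoint E (B s) →
    ∀ D ∈ F s, B t ∪ E ⊆ D ∨ Disjoint D (B t ∪ E)

/-- `s` has three different branches that meet `Y`. -/
def HasThreeBranches {ι V : Type*} (F : ι → Set (Set V)) (Y : Finset V) (s : ι) : Prop :=
  ∃ D₁ ∈ F s, ∃ D₂ ∈ F s, ∃ D₃ ∈ F s, D₁ ≠ D₂ ∧ D₁ ≠ D₃ ∧ D₂ ≠ D₃ ∧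
    (∃ y ∈ Y, y ∈ D₁) ∧ (∃ y ∈ Y, y ∈ D₂) ∧ ∃ y ∈ Y, y ∈ D₃

namespace IsBranchSystem

variable {ι V : Type*} {I : Set ι} {B : ι → Set V} {F : ι → Set (Set V)}

theorem eq_of_subset (h : IsBranchSystem I B F) {s t : ι} (hs : s ∈ I) (ht : t ∈ I)
    {D E : Set V} (hD : D ∈ F t) (hE : E ∈ F t) (hsD : B s ⊆ D) (hsE : B s ⊆ E) : D = E := by
  by_contra hne
  obtain ⟨x, hx⟩ := h.nonempty s hs
  exact Set.disjoint_left.1 (h.disjoint t ht D hD E hE hne) (hsD hx) (hsE hx)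

/-- Branches of `s` are disjoint, so at most one contains `B t`, and the others avoid it. Discarding
that one and `D` leaves at least one of the three. -/
theorem exists_branch_ne (h : IsBranchSystem I B F) {Y : Finset V} {s t : ι} (hs : s ∈ I)
    (ht : t ∈ I) (hst : s ≠ t) (h3 : HasThreeBranches F Y s) (D : Set V) :
    ∃ E ∈ F s, E ≠ D ∧ Disjoint E (B t) ∧ ∃ y ∈ Y, y ∈ E := by
  obtain ⟨D₁, h₁, D₂, h₂, D₃, h₃, h12, h13, h23, y₁, y₂, y₃⟩ := h3
  by_contra! hcon
  have key : ∀ E ∈ F s, (∃ y ∈ Y, y ∈ E) → E ≠ D → B t ⊆ E := by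
    intro E hE hy hED
    rcases h.subset_or_disjoint t ht s hs hst.symm E hE with h' | h'
    · exact h'
    · obtain ⟨y, hy, hyE⟩ := hy
      exact absurd hyE (hcon E hE hED h' y hy)
  by_cases e1 : D₁ = D
  · exact h23 (h.eq_of_subset ht hs h₂ h₃ (key _ h₂ y₂ (e1 ▸ h12.symm)) (key _ h₃ y₃ (e1 ▸ h13.symm)))
  · by_cases e2 : D₂ = D
    · exact h13 (h.eq_of_subset ht hs h₁ h₃ (key _ h₁ y₁ e1) (key _ h₃ y₃ (e2 ▸ h23.symm)))
    · exact h12 (h.eq_of_subset ht hs h₁ h₂ (key _ h₁ y₁ e1) (key _ h₂ y₂ e2))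

open Classical in
-- Descent: if `D` contains some `B t`, a branch of `t` avoiding `B s` lies in `D` and contains
-- strictly fewer of the sets, since it misses `B t` itself.
theorem exists_leaf (h : IsBranchSystem I B F) {S : Finset ι} (hSI : ↑S ⊆ I) {Y : Finset V}
    (h3 : ∀ s ∈ S, HasThreeBranches F Y s) (n : ℕ) :
    ∀ s ∈ S, ∀ D ∈ F s, (∃ y ∈ Y, y ∈ D) → (S.filter fun t => B t ⊆ D).card = n →
      ∃ s ∈ S, ∃ D ∈ F s, (∃ y ∈ Y, y ∈ D) ∧ ∀ t ∈ S, ¬ B t ⊆ D := by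
  induction n using Nat.strong_induction_on with
  | _ n ih =>
    intro s hs D hD hDY hn
    by_cases hleaf : ∀ t ∈ S, ¬ B t ⊆ D
    · exact ⟨s, hs, D, hD, hDY, hleaf⟩
    push Not at hleaf
    obtain ⟨t, ht, htD⟩ := hleaf
    have hst : s ≠ t := by
      rintro rfl
      obtain ⟨x, hx⟩ := h.nonempty s (hSI hs)
      exact Set.disjoint_left.1 (h.disjoint_self s (hSI hs) D hD) (htD hx) hx
    -- No branch needs to be excluded here, so `∅` is a dummy.
    obtain ⟨E, hE, -, hEs, hEY⟩ := h.exists_branch_ne (hSI ht) (hSI hs) hst.symm (h3 t ht) ∅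
    have hsub : B t ∪ E ⊆ D := by
      rcases h.union_subset_or_disjoint s (hSI hs) t (hSI ht) hst E hE hEs D hD with h' | h'
      · exact h'
      · obtain ⟨x, hx⟩ := h.nonempty t (hSI ht)
        exact absurd (Or.inl hx) (Set.disjoint_left.1 h' (htD hx))
    refine ih _ ?_ t ht E hE hEY rfl
    rw [← hn]
    refine Finset.card_lt_card (Finset.ssubset_iff_of_subset ?_ |>.2 ⟨t, ?_, ?_⟩)
    · intro r hr
      rw [Finset.mem_filter] at hr ⊢
      exact ⟨hr.1, hr.2.trans (Set.subset_union_right.trans hsub)⟩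
    · exact Finset.mem_filter.2 ⟨ht, htD⟩
    · intro h'
      obtain ⟨x, hx⟩ := h.nonempty t (hSI ht)
      exact Set.disjoint_left.1 (h.disjoint_self t (hSI ht) E hE) ((Finset.mem_filter.1 h').2 hx) hx

open Classical in
/-- There are at most as many branching indices as end points. -/
theorem card_le_card (h : IsBranchSystem I B F) (n : ℕ) :
    ∀ (S : Finset ι) (Y : Finset V), ↑S ⊆ I → (∀ s ∈ S, HasThreeBranches F Y s) →
      S.card = n → n ≤ Y.card := by
  induction n with
  | zero => intros; exact Nat.zero_le _
  | succ n ih =>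
    intro S Y hSI h3 hS
    obtain ⟨s₀, hs₀⟩ := Finset.card_pos.1 (by omega : 0 < S.card)
    obtain ⟨D₀, hD₀, -, -, -, -, -, -, -, hy₀, -⟩ := h3 s₀ hs₀
    obtain ⟨s, hs, D, hD, ⟨y, hy, hyD⟩, hleaf⟩ :=
      h.exists_leaf hSI h3 _ s₀ hs₀ D₀ hD₀ hy₀ rfl
    have hlt : (Y.filter fun y => y ∉ D).card < Y.card :=
      Finset.card_lt_card (Finset.filter_ssubset.2 ⟨y, hy, not_not.2 hyD⟩)
    -- Prune the leaf: drop `s` and all end points in `D`, at least one of which exists.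
    refine Nat.succ_le_of_lt (lt_of_le_of_lt (ih (S.erase s) (Y.filter fun y => y ∉ D) ?_ ?_ ?_) hlt)
    · exact (Finset.coe_subset.2 (Finset.erase_subset _ _)).trans hSI
    · intro t ht
      obtain ⟨hts, htS⟩ := Finset.mem_erase.1 ht
      -- A branch of `t` keeps an end point off `D`. If it contains `B s`, it also contains a second
      -- branch of `s`, disjoint from `D`. Otherwise it is itself disjoint from `D`, because `D`
      -- does not contain `B t`.
      have key : ∀ E ∈ F t, (∃ y ∈ Y, y ∈ E) → ∃ y ∈ Y.filter fun y => y ∉ D, y ∈ E := by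
        rintro E hE ⟨z, hz, hzE⟩
        rcases h.subset_or_disjoint s (hSI hs) t (hSI htS) hts.symm E hE with h' | h'
        · obtain ⟨D', hD', hne, hdisj, w, hw, hwD'⟩ :=
            h.exists_branch_ne (hSI hs) (hSI htS) hts.symm (h3 s hs) D
          refine ⟨w, Finset.mem_filter.2 ⟨hw, fun hwD => ?_⟩, ?_⟩
          · exact Set.disjoint_left.1 (h.disjoint s (hSI hs) D' hD' D hD hne) hwD' hwD
          · exact h.subset_of_subset s (hSI hs) t (hSI htS) hts.symm E hE h' D' hD' hdisj hwD'
        · rcases h.union_subset_or_disjoint s (hSI hs) t (hSI htS) hts.symm E hE h' D hD with h'' | h''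
          · exact absurd (Set.subset_union_left.trans h'') (hleaf t htS)
          · exact ⟨z, Finset.mem_filter.2 ⟨hz, fun hzD =>
              Set.disjoint_left.1 h'' hzD (Or.inr hzE)⟩, hzE⟩
      obtain ⟨D₁, h₁, D₂, h₂, D₃, h₃, h12, h13, h23, y₁, y₂, y₃⟩ := h3 t htS
      exact ⟨D₁, h₁, D₂, h₂, D₃, h₃, h12, h13, h23, key _ h₁ y₁, key _ h₂ y₂, key _ h₃ y₃⟩
    · rw [Finset.card_erase_of_mem hs, hS]; rfl

end IsBranchSystem

/-! ### Connectivity and components in the lattice -/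

theorem Adj.symm {u v : Site} (h : Adj u v) : Adj v u := by
  unfold Adj at *
  rw [abs_sub_comm v.1, abs_sub_comm v.2]
  exact h

/-- `x` and `y` are connected by a path in the set `A`. -/
def Conn (A : Set Site) (x y : Site) : Prop :=
  x ∈ A ∧ Relation.ReflTransGen (fun a b => Adj a b ∧ b ∈ A) x y

namespace Conn

variable {A A' : Set Site} {x y z : Site}

theorem refl (hx : x ∈ A) : Conn A x x := ⟨hx, .refl⟩

theorem left_mem (h : Conn A x y) : x ∈ A := h.1

theorem right_mem (h : Conn A x y) : y ∈ A := by
  obtain ⟨hx, h⟩ := h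
  cases h with
  | refl => exact hx
  | tail _ h => exact h.2

theorem step (h : Conn A x y) (hyz : Adj y z) (hz : z ∈ A) : Conn A x z :=
  ⟨h.1, h.2.tail ⟨hyz, hz⟩⟩

theorem trans (h : Conn A x y) (h' : Conn A y z) : Conn A x z := ⟨h.1, h.2.trans h'.2⟩

@[elab_as_elim]
theorem induction {P : (y : Site) → Conn A x y → Prop} (hx : ∀ h : x ∈ A, P x (refl h))
    (hstep : ∀ y z (h : Conn A x y) (hyz : Adj y z) (hz : z ∈ A), P y h → P z (h.step hyz hz))
    {y : Site} (h : Conn A x y) : P y h := by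
  obtain ⟨h0, h⟩ := h
  induction h with
  | refl => exact hx h0
  | tail hab hbc ih => exact hstep _ _ ⟨h0, hab⟩ hbc.1 hbc.2 ih

theorem of_adj (hx : x ∈ A) (hxy : Adj x y) (hy : y ∈ A) : Conn A x y := (refl hx).step hxy hy

theorem symm (h : Conn A x y) : Conn A y x := by
  induction h using Conn.induction with
  | hx h => exact refl h
  | hstep y z h hyz hz ih => exact (of_adj hz hyz.symm h.right_mem).trans ih

theorem mono (hA : A ⊆ A') (h : Conn A x y) : Conn A' x y := by
  induction h using Conn.induction with
  | hx h => exact refl (hA h)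
  | hstep y z h hyz hz ih => exact ih.step hyz (hA hz)

/-- A path from `x` stays in the component of `x`. -/
theorem of_forall_mem (h : Conn A x y) (hA : ∀ z, Conn A x z → z ∈ A') : Conn A' x y := by
  induction h using Conn.induction with
  | hx h => exact refl (hA _ (refl h))
  | hstep y z h hyz hz ih => exact ih.step hyz (hA _ (h.step hyz hz))

end Conn

/-- The component of `x` in `A`. -/
def component (A : Set Site) (x : Site) : Set Site := {y | Conn A x y}

theorem component_eq {A : Set Site} {x y : Site} (h : Conn A x y) :
    component A x = component A y :=
  Set.ext fun _ => ⟨fun hz => h.symm.trans hz, fun hz => h.trans hz⟩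

theorem disjoint_component {A : Set Site} {x y : Site} (h : component A x ≠ component A y) :
    Disjoint (component A x) (component A y) :=
  Set.disjoint_left.2 fun _ hx hy => h ((component_eq hx).trans (component_eq hy).symm)

/-- The components of `A \ B` that are adjacent to `B`. -/
def branches (A B : Set Site) : Set (Set Site) :=
  {D | ∃ x ∈ A \ B, (∃ b ∈ B, Adj b x) ∧ D = component (A \ B) x}

/-- A connected subset of `A` avoiding `B t` lies in one component of `A \ B t` or misses it. The
nesting axioms apply this to `B s`, to a branch together with the adjacent set it hangs on, and to a
branch of `s` avoiding `B t`. -/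
theorem isBranchSystem_branches {ι : Type*} {I : Set ι} {A : Set Site} {B : ι → Set Site}
    (hne : ∀ s ∈ I, (B s).Nonempty) (hA : ∀ s ∈ I, B s ⊆ A)
    (hconn : ∀ s ∈ I, ∀ x ∈ B s, ∀ y ∈ B s, Conn (B s) x y)
    (hdisj : ∀ s ∈ I, ∀ t ∈ I, s ≠ t → Disjoint (B s) (B t)) :
    IsBranchSystem I B fun s => branches A (B s) := by
  have hsub : ∀ s ∈ I, ∀ t ∈ I, s ≠ t → B s ⊆ A \ B t := fun s hs t ht hst x hx =>
    ⟨hA s hs hx, Set.disjoint_left.1 (hdisj s hs t ht hst) hx⟩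
  refine ⟨hne, ?_, ?_, ?_, ?_, ?_⟩
  · rintro s - D ⟨x, -, -, rfl⟩
    exact Set.disjoint_left.2 fun z hz => hz.right_mem.2
  · rintro s - D ⟨x, -, -, rfl⟩ E ⟨y, -, -, rfl⟩ h
    exact disjoint_component h
  · rintro s hs t ht hst E ⟨x, -, -, rfl⟩
    by_cases h : Disjoint (component (A \ B t) x) (B s)
    · exact Or.inr h
    · obtain ⟨z, hz, hzs⟩ := Set.not_disjoint_iff.1 h
      exact Or.inl fun w hw => Conn.trans hz ((hconn s hs z hzs w hw).mono (hsub s hs t ht hst))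
  · rintro s hs t ht hst E ⟨y, hy, -, rfl⟩ hBE D ⟨x, hx, ⟨b, hb, hbx⟩, rfl⟩ hD z hz
    have hmem : ∀ w, Conn (A \ B s) x w → w ∈ A \ B t := fun w hw =>
      ⟨hw.right_mem.1, Set.disjoint_left.1 hD hw⟩
    exact (Conn.step (hBE hb) hbx (hmem x (Conn.refl hx))).trans (Conn.of_forall_mem hz hmem)
  · rintro s hs t ht hst E ⟨y, hy, ⟨b, hb, hby⟩, rfl⟩ hE D ⟨x, hx, -, rfl⟩
    have key : ∀ z ∈ B t ∪ component (A \ B t) y, Conn (A \ B s) b z := by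
      rintro z (hz | hz)
      · exact (hconn t ht b hb z hz).mono (hsub t ht s hs hst.symm)
      · have hmem : ∀ w, Conn (A \ B t) y w → w ∈ A \ B s := fun w hw =>
          ⟨hw.right_mem.1, Set.disjoint_left.1 hE hw⟩
        exact (Conn.of_adj (hsub t ht s hs hst.symm hb) hby (hmem y (Conn.refl hy))).trans
          (Conn.of_forall_mem hz hmem)
    by_cases h : Disjoint (component (A \ B s) x) (B t ∪ component (A \ B t) y)
    · exact Or.inr h
    · obtain ⟨z, hz, hzt⟩ := Set.not_disjoint_iff.1 h
      exact Or.inl fun w hw => Conn.trans hz ((key z hzt).symm.trans (key w hw))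

/-! ### Norms and boxes -/

/-- The `ℓ^∞`-norm of a site. -/
def supNorm (u : Site) : ℤ := max |u.1| |u.2|

theorem supNorm_le_iff {u : Site} {n : ℤ} :
    supNorm u ≤ n ↔ (-n ≤ u.1 ∧ u.1 ≤ n) ∧ -n ≤ u.2 ∧ u.2 ≤ n := by
  rw [supNorm, max_le_iff, abs_le, abs_le]

theorem Adj.cases {u v : Site} (h : Adj u v) :
    (v.1 = u.1 + 1 ∧ v.2 = u.2) ∨ (v.1 = u.1 - 1 ∧ v.2 = u.2) ∨
      (v.1 = u.1 ∧ v.2 = u.2 + 1) ∨ (v.1 = u.1 ∧ v.2 = u.2 - 1) := by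
  unfold Adj at h
  have h1 := abs_cases (u.1 - v.1)
  have h2 := abs_cases (u.2 - v.2)
  omega

theorem Adj.supNorm_le {u v : Site} (h : Adj u v) : supNorm v ≤ supNorm u + 1 := by
  have hu := supNorm_le_iff.1 (le_refl (supNorm u))
  rw [supNorm_le_iff]
  have := h.cases
  omega

theorem finite_supNorm_le (n : ℤ) : {u : Site | supNorm u ≤ n}.Finite := by
  refine (((Finset.Icc (-n) n) ×ˢ (Finset.Icc (-n) n)).finite_toSet).subset fun u hu => ?_
  rw [Set.mem_ofPred_eq, supNorm_le_iff] at hu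
  simpa only [Finset.coe_product, Finset.coe_Icc, Set.mem_prod, Set.mem_Icc] using hu

theorem infinite_iff_supNorm {S : Set Site} :
    S.Infinite ↔ ∀ n : ℕ, ∃ u, u ∈ S ∧ (n : ℤ) < supNorm u := by
  constructor
  · intro h n
    obtain ⟨u, hu, hn⟩ := h.exists_notMem_finite (finite_supNorm_le n)
    exact ⟨u, hu, not_le.1 hn⟩
  · intro h hS
    obtain ⟨b, hb⟩ := (hS.image supNorm).bddAbove
    obtain ⟨u, hu, hlt⟩ := h b.toNat
    have := hb (Set.mem_image_of_mem _ hu)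
    omega

/-- A discrete intermediate value theorem: the norm rises by at most 1 per step. -/
theorem Conn.exists_supNorm_eq {A : Set Site} {x y : Site} (h : Conn A x y) {r : ℤ}
    (hx : supNorm x ≤ r) (hy : r ≤ supNorm y) : ∃ z, Conn A x z ∧ supNorm z = r := by
  induction h using Conn.induction with
  | hx h => exact ⟨x, Conn.refl h, le_antisymm hx hy⟩
  | hstep b c h hbc hc ih =>
    rcases le_or_gt r (supNorm b) with hb | hb
    · exact ih hb
    · exact ⟨c, h.step hbc hc, by have := hbc.supNorm_le; omega⟩

/-- The square of radius `n` around `c`. -/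
def box (n : ℕ) (c : Site) : Set Site := {u | supNorm (u - c) ≤ n}

theorem mem_box {n : ℕ} {c u : Site} : u ∈ box n c ↔
    (c.1 - n ≤ u.1 ∧ u.1 ≤ c.1 + n) ∧ c.2 - n ≤ u.2 ∧ u.2 ≤ c.2 + n := by
  rw [box, Set.mem_ofPred_eq, supNorm_le_iff]
  simp only [Prod.fst_sub, Prod.snd_sub]
  omega

theorem mem_box_zero {n : ℕ} {u : Site} : u ∈ box n 0 ↔ supNorm u ≤ n := by
  rw [box, Set.mem_ofPred_eq, sub_zero]

theorem center_mem_box (n : ℕ) (c : Site) : c ∈ box n c := by rw [mem_box]; omega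

theorem finite_box_zero (n : ℕ) : (box n 0).Finite :=
  (finite_supNorm_le n).subset fun _ hu => mem_box_zero.1 hu

theorem conn_box_center (n : ℕ) (c : Site) (k : ℕ) :
    ∀ u ∈ box n c, |u.1 - c.1| + |u.2 - c.2| = k → Conn (box n c) u c := by
  induction k with
  | zero =>
    intro u hu h
    have : u = c := by
      have h1 := abs_nonneg (u.1 - c.1)
      have h2 := abs_nonneg (u.2 - c.2)
      ext
      · have : |u.1 - c.1| = 0 := by omega
        have := abs_eq_zero.1 this; omega
      · have : |u.2 - c.2| = 0 := by omega
        have := abs_eq_zero.1 this; omega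
    rw [this]
    exact Conn.refl (center_mem_box n c)
  | succ k ih =>
    intro u hu h
    have hu' := mem_box.1 hu
    have h1 := abs_cases (u.1 - c.1)
    have h2 := abs_cases (u.2 - c.2)
    obtain ⟨v, hv, hadj, hk⟩ : ∃ v ∈ box n c, Adj u v ∧ |v.1 - c.1| + |v.2 - c.2| = k := by
      rcases lt_trichotomy u.1 c.1 with hlt | heq | hlt
      · refine ⟨(u.1 + 1, u.2), mem_box.2 (by simp only; omega), by simp [Adj], ?_⟩
        have h3 := abs_cases (u.1 + 1 - c.1)
        simp only; omega
      · rcases lt_trichotomy u.2 c.2 with hlt' | heq' | hlt'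
        · refine ⟨(u.1, u.2 + 1), mem_box.2 (by simp only; omega), by simp [Adj], ?_⟩
          have h3 := abs_cases (u.2 + 1 - c.2)
          simp only; omega
        · omega
        · refine ⟨(u.1, u.2 - 1), mem_box.2 (by simp only; omega), by simp [Adj], ?_⟩
          have h3 := abs_cases (u.2 - 1 - c.2)
          simp only; omega
      · refine ⟨(u.1 - 1, u.2), mem_box.2 (by simp only; omega), by simp [Adj], ?_⟩
        have h3 := abs_cases (u.1 - 1 - c.1)
        simp only; omega
    exact (Conn.of_adj hu hadj hv).trans (ih v hv hk)

theorem conn_box {n : ℕ} {c u v : Site} (hu : u ∈ box n c) (hv : v ∈ box n c) :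
    Conn (box n c) u v := by
  have key : ∀ w ∈ box n c, Conn (box n c) w c := fun w hw =>
    conn_box_center n c (|w.1 - c.1| + |w.2 - c.2|).toNat w hw (by
      have h1 := abs_nonneg (w.1 - c.1)
      have h2 := abs_nonneg (w.2 - c.2)
      omega)
  exact (key u hu).trans (key v hv).symm

/-! ### Open clusters, measurability and trifurcations -/

/-- The set of open sites. -/
def openSites (ω : Config) : Set Site := {u | ω u = true}

/-- Finite paths form a countable set, so this form yields measurability as well as the link to
`OpenConnected`. -/
theorem conn_iff_exists_path {A : Set Site} {u v : Site} : Conn A u v ↔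
    ∃ (n : ℕ) (w : Fin (n + 1) → Site), w 0 = u ∧ w (Fin.last n) = v ∧
      (∀ k, w k ∈ A) ∧ ∀ k : Fin n, Adj (w k.castSucc) (w k.succ) := by
  constructor
  · intro h
    induction h using Conn.induction with
    | hx h => exact ⟨0, fun _ => u, rfl, rfl, fun _ => h, fun k => k.elim0⟩
    | hstep y z h hyz hz ih =>
      obtain ⟨n, w, h0, hl, hA, hadj⟩ := ih
      refine ⟨n + 1, Fin.snoc (α := fun _ => Site) w z, ?_, ?_, ?_, ?_⟩
      · rw [← Fin.castSucc_zero, Fin.snoc_castSucc, h0]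
      · rw [Fin.snoc_last]
      · intro k
        refine Fin.lastCases ?_ (fun k => ?_) k
        · rwa [Fin.snoc_last]
        · rw [Fin.snoc_castSucc]; exact hA k
      · intro k
        refine Fin.lastCases ?_ (fun k => ?_) k
        · rw [Fin.snoc_castSucc, Fin.succ_last, Fin.snoc_last, hl]; exact hyz
        · rw [Fin.snoc_castSucc, Fin.succ_castSucc, Fin.snoc_castSucc]; exact hadj k
  · rintro ⟨n, w, rfl, rfl, hA, hadj⟩
    have key : ∀ k : Fin (n + 1), Conn A (w 0) (w k) := by
      intro k
      induction k using Fin.induction with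
      | zero => exact Conn.refl (hA 0)
      | succ k ih => exact ih.step (hadj k) (hA _)
    exact key _

theorem cluster_eq_component (ω : Config) (u : Site) :
    cluster ω u = component (openSites ω) u :=
  Set.ext fun _ => Iff.symm (conn_iff_exists_path (A := openSites ω))

theorem measurable_apply (u : Site) : Measurable fun ω : Config => ω u = true :=
  measurableSet_setOfPred.1
    ((measurable_pi_apply (X := fun _ : Site => Bool) u) (measurableSet_singleton true))

theorem measurable_conn (B : Set Site) (u v : Site) :
    Measurable fun ω : Config => Conn (openSites ω \ B) u v := by
  simp only [conn_iff_exists_path]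
  refine Measurable.exists fun n => Measurable.exists fun w => ?_
  refine measurable_const.and (measurable_const.and (Measurable.and ?_ measurable_const))
  exact Measurable.forall fun k => (measurable_apply (w k)).and measurable_const

theorem measurable_infinite_component (B : Set Site) (u : Site) :
    Measurable fun ω : Config => (component (openSites ω \ B) u).Infinite := by
  simp only [infinite_iff_supNorm]
  exact Measurable.forall fun n => Measurable.exists fun v =>
    (measurable_conn B u v).and measurable_const

/-- `x` starts an infinite branch at the box `box n c`. -/
def IsBranchPoint (n : ℕ) (c : Site) (ω : Config) (x : Site) : Prop :=
  x ∈ openSites ω \ box n c ∧ (∃ b ∈ box n c, Adj b x) ∧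
    (component (openSites ω \ box n c) x).Infinite

/-- The box `box n c` is open and its removal leaves at least three infinite branches. -/
def IsTrifurcation (n : ℕ) (c : Site) (ω : Config) : Prop :=
  box n c ⊆ openSites ω ∧ ∃ x y z, IsBranchPoint n c ω x ∧ IsBranchPoint n c ω y ∧
    IsBranchPoint n c ω z ∧ ¬ Conn (openSites ω \ box n c) x y ∧
    ¬ Conn (openSites ω \ box n c) x z ∧ ¬ Conn (openSites ω \ box n c) y z

theorem measurable_isBranchPoint (n : ℕ) (c x : Site) :
    Measurable fun ω => IsBranchPoint n c ω x :=
  ((measurable_apply x).and measurable_const).and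
    (measurable_const.and (measurable_infinite_component _ x))

theorem measurable_isTrifurcation (n : ℕ) (c : Site) :
    Measurable fun ω => IsTrifurcation n c ω := by
  refine Measurable.and ?_ (Measurable.exists fun x => Measurable.exists fun y =>
    Measurable.exists fun z => (measurable_isBranchPoint n c x).and
      ((measurable_isBranchPoint n c y).and ((measurable_isBranchPoint n c z).and
      ((measurable_conn _ x y).not.and ((measurable_conn _ x z).not.and
        (measurable_conn _ y z).not)))))
  exact Measurable.forall fun u => measurable_const.imp (measurable_apply u)

/-! ### Translations -/

theorem conn_translate {A A' : Set Site} {c x y : Site} (hA : ∀ u, u ∈ A' → u + c ∈ A)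
    (h : Conn A' x y) : Conn A (x + c) (y + c) := by
  induction h using Conn.induction with
  | hx h => exact Conn.refl (hA _ h)
  | hstep y z h hyz hz ih =>
    refine ih.step ?_ (hA _ hz)
    simpa [Adj] using hyz

theorem conn_translate_iff {A A' : Set Site} {c x y : Site} (hA : ∀ u, u ∈ A' ↔ u + c ∈ A) :
    Conn A' x y ↔ Conn A (x + c) (y + c) := by
  refine ⟨conn_translate fun u => (hA u).1, fun h => ?_⟩
  have := conn_translate (c := -c) (A := A') (fun u hu => (hA _).2 (by simpa using hu)) h
  simpa using this

theorem infinite_component_translate_iff {A A' : Set Site} {c x : Site}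
    (hA : ∀ u, u ∈ A' ↔ u + c ∈ A) :
    (component A' x).Infinite ↔ (component A (x + c)).Infinite := by
  have : component A (x + c) = (fun u => u + c) '' component A' x := by
    ext y
    constructor
    · intro hy
      refine ⟨y - c, (conn_translate_iff hA).2 ?_, sub_add_cancel y c⟩
      rw [sub_add_cancel]
      exact hy
    · rintro ⟨z, hz, rfl⟩
      exact (conn_translate_iff hA).1 hz
  rw [this, Set.infinite_image_iff (add_left_injective c).injOn]

theorem mem_openSites_shift {c u : Site} {ω : Config} :
    u ∈ openSites (shift c ω) ↔ u + c ∈ openSites ω := Iff.rfl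

theorem mem_box_translate {n : ℕ} {c u : Site} : u ∈ box n 0 ↔ u + c ∈ box n c := by
  simp [box]

theorem mem_openSites_diff_box_shift {n : ℕ} {c u : Site} {ω : Config} :
    u ∈ openSites (shift c ω) \ box n 0 ↔ u + c ∈ openSites ω \ box n c :=
  and_congr mem_openSites_shift (not_congr mem_box_translate)

theorem isBranchPoint_shift {n : ℕ} {c x : Site} {ω : Config}
    (h : IsBranchPoint n 0 (shift c ω) x) : IsBranchPoint n c ω (x + c) := by
  obtain ⟨hx, ⟨b, hb, hadj⟩, hinf⟩ := h
  refine ⟨mem_openSites_diff_box_shift.1 hx, ⟨b + c, mem_box_translate.1 hb, ?_⟩,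
    (infinite_component_translate_iff fun _ => mem_openSites_diff_box_shift).1 hinf⟩
  simpa [Adj] using hadj

theorem isTrifurcation_of_shift {n : ℕ} {c : Site} {ω : Config}
    (h : IsTrifurcation n 0 (shift c ω)) : IsTrifurcation n c ω := by
  obtain ⟨hB, x, y, z, hx, hy, hz, hxy, hxz, hyz⟩ := h
  have key : ∀ {u v}, Conn (openSites (shift c ω) \ box n 0) u v ↔
      Conn (openSites ω \ box n c) (u + c) (v + c) :=
    conn_translate_iff fun _ => mem_openSites_diff_box_shift
  refine ⟨fun u hu => ?_, x + c, y + c, z + c, isBranchPoint_shift hx, isBranchPoint_shift hy,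
    isBranchPoint_shift hz, fun h => hxy (key.2 h), fun h => hxz (key.2 h), fun h => hyz (key.2 h)⟩
  have h1 : u - c ∈ box n 0 := mem_box_translate (c := c) |>.2 (by simpa using hu)
  simpa using mem_openSites_shift.1 (hB h1)

/-! ### Counting trifurcation boxes -/

/-- The sites of norm `r`. -/
noncomputable def sphere (r : ℕ) : Finset Site :=
  ((Finset.Icc (-r : ℤ) r) ×ˢ (Finset.Icc (-r : ℤ) r)).filter fun u => supNorm u = r

theorem mem_sphere {r : ℕ} {u : Site} : u ∈ sphere r ↔ supNorm u = r := by
  rw [sphere, Finset.mem_filter, Finset.mem_product, Finset.mem_Icc, Finset.mem_Icc,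
    ← supNorm_le_iff]
  exact ⟨fun h => h.2, fun h => ⟨h.le, h⟩⟩

theorem card_sphere_le (r : ℕ) : (sphere r).card ≤ 4 * (2 * r + 1) := by
  have hsub : sphere r ⊆ ({(r : ℤ), -(r : ℤ)} : Finset ℤ) ×ˢ Finset.Icc (-r : ℤ) r ∪
      Finset.Icc (-r : ℤ) r ×ˢ ({(r : ℤ), -(r : ℤ)} : Finset ℤ) := by
    intro u hu
    have h := mem_sphere.1 hu
    have h1 := supNorm_le_iff.1 h.le
    have h2 : supNorm u = |u.1| ∨ supNorm u = |u.2| := max_choice _ _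
    have h3 := abs_cases u.1
    have h4 := abs_cases u.2
    simp only [Finset.mem_union, Finset.mem_product, Finset.mem_insert, Finset.mem_singleton,
      Finset.mem_Icc]
    omega
  have hcard : (Finset.Icc (-r : ℤ) r).card = 2 * r + 1 := by rw [Int.card_Icc]; omega
  have h2 : ({(r : ℤ), -(r : ℤ)} : Finset ℤ).card ≤ 2 := Finset.card_le_two
  calc _ ≤ _ := Finset.card_le_card hsub
    _ ≤ _ := Finset.card_union_le _ _
    _ ≤ 4 * (2 * r + 1) := by
      rw [Finset.card_product, Finset.card_product, hcard]
      nlinarith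

open Classical in
-- The boxes around multiples of `2 * n + 1` are disjoint and connected, so their branches form a
-- branch system. All of them lie strictly inside the sphere, which every infinite branch must
-- therefore cross.
theorem card_trifurcation_le (n k : ℕ) (ω : Config) :
    (((Finset.Icc (-k : ℤ) k) ×ˢ (Finset.Icc (-k : ℤ) k)).filter fun z : Site =>
      IsTrifurcation n ((2 * n + 1 : ℤ) • z) ω).card ≤
      (sphere ((2 * n + 1) * k + n + 1)).card := by
  set S := ((Finset.Icc (-k : ℤ) k) ×ˢ (Finset.Icc (-k : ℤ) k)).filter fun z : Site =>
      IsTrifurcation n ((2 * n + 1 : ℤ) • z) ω with hS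
  set B : Site → Set Site := fun z => box n ((2 * n + 1 : ℤ) • z) with hB
  have hsys := isBranchSystem_branches (I := (S : Set Site)) (A := openSites ω) (B := B)
    (fun s _ => ⟨_, center_mem_box _ _⟩)
    (fun s hs => (Finset.mem_filter.1 (Finset.mem_coe.1 hs)).2.1)
    (fun s _ x hx y hy => conn_box hx hy) (by
      intro s _ t _ hst
      refine Set.disjoint_left.2 fun u hu hu' => hst ?_
      have h1 := mem_box.1 hu
      have h2 := mem_box.1 hu'
      simp only [Prod.smul_fst, Prod.smul_snd, smul_eq_mul] at h1 h2
      have key : ∀ a b w : ℤ, (2 * n + 1 : ℤ) * a - n ≤ w → w ≤ (2 * n + 1 : ℤ) * a + n →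
          (2 * n + 1 : ℤ) * b - n ≤ w → w ≤ (2 * n + 1 : ℤ) * b + n → a ≤ b := by
        intro a b w ha1 ha2 hb1 hb2
        by_contra! hlt
        have : (2 * n + 1 : ℤ) * (b + 1) ≤ (2 * n + 1 : ℤ) * a :=
          mul_le_mul_of_nonneg_left hlt (by positivity)
        linarith
      ext
      · exact le_antisymm (key _ _ u.1 h1.1.1 h1.1.2 h2.1.1 h2.1.2)
          (key _ _ u.1 h2.1.1 h2.1.2 h1.1.1 h1.1.2)
      · exact le_antisymm (key _ _ u.2 h1.2.1 h1.2.2 h2.2.1 h2.2.2)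
          (key _ _ u.2 h2.2.1 h2.2.2 h1.2.1 h1.2.2))
  refine hsys.card_le_card _ S _ subset_rfl ?_ rfl
  intro s hs
  obtain ⟨hsk, hsB, x, y, z, hx, hy, hz, hxy, hxz, hyz⟩ := Finset.mem_filter.1 hs
  have hbranch : ∀ w, IsBranchPoint n ((2 * n + 1 : ℤ) • s) ω w →
      component (openSites ω \ B s) w ∈ branches (openSites ω) (B s) := fun w hw =>
    ⟨w, hw.1, hw.2.1, rfl⟩
  have hne : ∀ v w, IsBranchPoint n ((2 * n + 1 : ℤ) • s) ω w →
      ¬ Conn (openSites ω \ B s) v w →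
      component (openSites ω \ B s) v ≠ component (openSites ω \ B s) w := by
    intro v w hw hvw heq
    have : w ∈ component (openSites ω \ B s) w := Conn.refl hw.1
    rw [← heq] at this
    exact hvw this
  have hmeet : ∀ w, IsBranchPoint n ((2 * n + 1 : ℤ) • s) ω w →
      ∃ y ∈ sphere ((2 * n + 1) * k + n + 1), y ∈ component (openSites ω \ B s) w := by
    intro w hw
    obtain ⟨v, hv, hlt⟩ := infinite_iff_supNorm.1 hw.2.2 ((2 * n + 1) * k + n + 1)
    obtain ⟨b, hb, hadj⟩ := hw.2.1
    have hb' := mem_box.1 hb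
    simp only [Prod.smul_fst, Prod.smul_snd, smul_eq_mul] at hb'
    simp only [Finset.mem_product, Finset.mem_Icc] at hsk
    have hn : (0 : ℤ) ≤ 2 * n + 1 := by positivity
    have e1 := mul_le_mul_of_nonneg_left hsk.1.1 hn
    have e2 := mul_le_mul_of_nonneg_left hsk.1.2 hn
    have e3 := mul_le_mul_of_nonneg_left hsk.2.1 hn
    have e4 := mul_le_mul_of_nonneg_left hsk.2.2 hn
    have hbn : supNorm b ≤ (2 * n + 1) * k + n := by
      rw [supNorm_le_iff]
      refine ⟨⟨?_, ?_⟩, ?_, ?_⟩ <;> linarith [hb'.1.1, hb'.1.2, hb'.2.1, hb'.2.2]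
    have hwn := hadj.supNorm_le
    obtain ⟨u, hu, hur⟩ := Conn.exists_supNorm_eq hv
      (r := (((2 * n + 1) * k + n + 1 : ℕ) : ℤ)) (by push_cast; linarith) hlt.le
    exact ⟨u, mem_sphere.2 hur, hu⟩
  exact ⟨_, hbranch x hx, _, hbranch y hy, _, hbranch z hz, hne x y hy hxy, hne x z hz hxz,
    hne y z hz hyz, hmeet x hx, hmeet y hy, hmeet z hz⟩

/-- Taking expectations in the counting bound, `(2 * k + 1) ^ 2 * a` is at most linear in `k`, which
forces `a = 0`. -/
theorem measure_isTrifurcation_zero (p : unitInterval) (n : ℕ) :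
    (law p).real {ω | IsTrifurcation n 0 ω} = 0 := by
  classical
  set a := (law p).real {ω | IsTrifurcation n 0 ω} with ha
  have hle : ∀ c, a ≤ (law p).real {ω | IsTrifurcation n c ω} := by
    intro c
    have h := (measurePreserving_shift p c).measure_preimage
      (measurableSet_setOfPred.2 (measurable_isTrifurcation n 0)).nullMeasurableSet
    rw [ha, measureReal_def, ← h]
    exact measureReal_mono fun ω hω => isTrifurcation_of_shift hω
  have hbound : ∀ k : ℕ, (2 * (k : ℝ) + 1) * a ≤ 4 * (2 * n + 3) := by
    intro k
    set Q := (Finset.Icc (-k : ℤ) k) ×ˢ (Finset.Icc (-k : ℤ) k) with hQ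
    have hQc : (Q.card : ℝ) = (2 * k + 1) ^ 2 := by
      rw [hQ, Finset.card_product, Nat.cast_mul, card_Icc_neg_self, sq]
    set E : Site → Set Config := fun z => {ω | IsTrifurcation n ((2 * n + 1 : ℤ) • z) ω} with hE
    have hEm : ∀ z, MeasurableSet (E z) := fun z =>
      measurableSet_setOfPred.2 (measurable_isTrifurcation n _)
    have h1 : ∑ z ∈ Q, (law p).real (E z) =
        ∫ ω, ∑ z ∈ Q, (E z).indicator (fun _ => (1 : ℝ)) ω ∂law p := by
      rw [integral_finsetSum _ fun z _ => (integrable_const 1).indicator (hEm z)]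
      exact Finset.sum_congr rfl fun z _ => (integral_indicator_one (hEm z)).symm
    have h2 : ∫ ω, ∑ z ∈ Q, (E z).indicator (fun _ => (1 : ℝ)) ω ∂law p ≤
        ∫ _, ((4 * (2 * ((2 * n + 1) * k + n + 1) + 1) : ℕ) : ℝ) ∂law p := by
      refine integral_mono (integrable_finsetSum _ fun z _ =>
        (integrable_const 1).indicator (hEm z)) (integrable_const _) fun ω => ?_
      have : ∑ z ∈ Q, (E z).indicator (fun _ => (1 : ℝ)) ω =
          ((Q.filter fun z : Site => IsTrifurcation n ((2 * n + 1 : ℤ) • z) ω).card : ℝ) := by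
        rw [Finset.card_filter, Nat.cast_sum]
        refine Finset.sum_congr rfl fun z _ => ?_
        simp [Set.indicator_apply, hE]
      simp only [this]
      exact_mod_cast (card_trifurcation_le n k ω).trans (card_sphere_le _)
    have h3 : Q.card • a ≤ ∑ z ∈ Q, (law p).real (E z) :=
      Finset.card_nsmul_le_sum _ _ _ fun z _ => hle _
    rw [nsmul_eq_mul, hQc] at h3
    rw [integral_const, probReal_univ, one_smul] at h2
    push_cast at h2
    have hk : (0 : ℝ) < 2 * k + 1 := by positivity
    refine le_of_mul_le_mul_left ?_ hk
    have hkn : (0 : ℝ) ≤ k := Nat.cast_nonneg k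
    have hnn : (0 : ℝ) ≤ n := Nat.cast_nonneg n
    nlinarith
  have ha0 : 0 ≤ a := measureReal_nonneg
  by_contra hne
  have hapos : 0 < a := lt_of_le_of_ne ha0 (Ne.symm hne)
  obtain ⟨k, hk⟩ := exists_nat_gt (4 * (2 * (n : ℝ) + 3) / a)
  rw [div_lt_iff₀ hapos] at hk
  have := hbound k
  nlinarith

/-! ### Uniqueness of the infinite cluster -/

/-- `x` lies in an infinite open cluster. -/
def InInfinite (ω : Config) (x : Site) : Prop := (component (openSites ω) x).Infinite

theorem InInfinite.mem_openSites {ω : Config} {x : Site} (h : InInfinite ω x) :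
    x ∈ openSites ω := by
  obtain ⟨y, hy⟩ := Set.Infinite.nonempty h
  exact Conn.left_mem hy

theorem InInfinite.of_conn {ω : Config} {x y : Site} (h : InInfinite ω x)
    (hxy : Conn (openSites ω) x y) : InInfinite ω y := by
  rwa [InInfinite, ← component_eq hxy]

theorem measurable_conn_openSites (u v : Site) :
    Measurable fun ω : Config => Conn (openSites ω) u v := by
  simpa only [Set.sdiff_empty] using measurable_conn ∅ u v

theorem measurable_inInfinite (x : Site) : Measurable fun ω => InInfinite ω x := by
  simpa only [InInfinite, Set.sdiff_empty] using measurable_infinite_component ∅ x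

theorem inInfinite_shift {c x : Site} {ω : Config} :
    InInfinite (shift c ω) x ↔ InInfinite ω (x + c) :=
  infinite_component_translate_iff fun _ => mem_openSites_shift

theorem conn_shift {c x y : Site} {ω : Config} :
    Conn (openSites (shift c ω)) x y ↔ Conn (openSites ω) (x + c) (y + c) :=
  conn_translate_iff fun _ => mem_openSites_shift

/-- All infinite clusters coincide. -/
def AtMostOneInfinite (ω : Config) : Prop :=
  ∀ x y, InInfinite ω x → InInfinite ω y → Conn (openSites ω) x y

/-- Three different infinite clusters meet the box of radius `n` around the origin. -/
def ThreeInfiniteMeet (n : ℕ) (ω : Config) : Prop :=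
  ∃ x ∈ box n 0, ∃ y ∈ box n 0, ∃ z ∈ box n 0, InInfinite ω x ∧ InInfinite ω y ∧
    InInfinite ω z ∧ ¬ Conn (openSites ω) x y ∧ ¬ Conn (openSites ω) x z ∧
    ¬ Conn (openSites ω) y z

/-- All infinite clusters meet the box of radius `n` around the origin. -/
def AllInfiniteMeet (n : ℕ) (ω : Config) : Prop :=
  ∀ x, InInfinite ω x → ∃ y ∈ box n 0, Conn (openSites ω) x y

theorem measurable_atMostOneInfinite : Measurable fun ω => AtMostOneInfinite ω :=
  Measurable.forall fun x => Measurable.forall fun y => (measurable_inInfinite x).imp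
    ((measurable_inInfinite y).imp (measurable_conn_openSites x y))

/-- There are at most two infinite clusters, and a box containing a site of each meets them all. -/
theorem exists_allInfiniteMeet {ω : Config} (h : ∀ n, ¬ ThreeInfiniteMeet n ω) :
    ∃ n, AllInfiniteMeet n ω := by
  have mem : ∀ {n : ℕ} {u : Site}, (supNorm u).toNat ≤ n → u ∈ box n 0 := by
    intro n u hu
    rw [mem_box_zero]
    omega
  by_cases h1 : ∃ x, InInfinite ω x
  · obtain ⟨x, hx⟩ := h1
    by_cases h2 : ∃ y, InInfinite ω y ∧ ¬ Conn (openSites ω) x y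
    · obtain ⟨y, hy, hxy⟩ := h2
      refine ⟨max (supNorm x).toNat (supNorm y).toNat, fun z hz => ?_⟩
      by_contra! hcon
      have hxz := hcon x (mem (le_max_left _ _))
      have hyz := hcon y (mem (le_max_right _ _))
      refine h (max (max (supNorm x).toNat (supNorm y).toNat) (supNorm z).toNat)
        ⟨x, mem (by omega), y, mem (by omega), z, mem (by omega), hx, hy, hz, hxy,
          fun h => hxz h.symm, fun h => hyz h.symm⟩
    · push Not at h2
      exact ⟨_, fun y hy => ⟨x, mem le_rfl, (h2 y hy).symm⟩⟩
  · exact ⟨0, fun x hx => absurd ⟨x, hx⟩ h1⟩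

open Classical in
/-- The configuration in which all sites of `B` are opened. -/
noncomputable def openUp (B : Set Site) (ω : Config) : Config :=
  fun u => if u ∈ B then true else ω u

theorem openSites_openUp (B : Set Site) (ω : Config) :
    openSites (openUp B ω) = openSites ω ∪ B := by
  ext u
  by_cases hu : u ∈ B <;> simp [openSites, openUp, hu]

theorem openSites_openUp_diff (B : Set Site) (ω : Config) :
    openSites (openUp B ω) \ B = openSites ω \ B := by
  rw [openSites_openUp, Set.union_sdiff_right]

/-- A cluster avoiding the opened box was already open before; if infinite, it would have met the
box. So all infinite clusters meet the box, which is open and connected. -/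
theorem atMostOneInfinite_openUp {n : ℕ} {ω : Config} (h : AllInfiniteMeet n ω) :
    AtMostOneInfinite (openUp (box n 0) ω) := by
  have hA := openSites_openUp (box n 0) ω
  have key : ∀ x, InInfinite (openUp (box n 0) ω) x →
      ∃ y ∈ box n 0, Conn (openSites (openUp (box n 0) ω)) x y := by
    intro x hx
    by_contra! hcon
    have hsub : ∀ z, Conn (openSites (openUp (box n 0) ω)) x z → z ∈ openSites ω := by
      intro z hz
      have h1 := hz.right_mem
      rw [hA] at h1
      exact h1.resolve_right fun h2 => hcon z h2 hz
    have hx' : InInfinite ω x :=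
      Set.Infinite.mono (fun z hz => Conn.of_forall_mem hz hsub) hx
    obtain ⟨y, hy, hxy⟩ := h x hx'
    exact hcon y hy (hxy.mono (hA ▸ Set.subset_union_left))
  intro x y hx hy
  obtain ⟨a, ha, hxa⟩ := key x hx
  obtain ⟨b, hb, hyb⟩ := key y hy
  exact (hxa.trans ((conn_box ha hb).mono (hA ▸ Set.subset_union_right))).trans hyb.symm

/-- The cluster is covered by the finite box and the components outside it that start at one of
finitely many neighbours, so one of these is infinite. -/
theorem exists_isBranchPoint {n : ℕ} {ω : Config} {x : Site} (hx : x ∈ box n 0)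
    (hinf : InInfinite ω x) : ∃ y, Conn (openSites ω) x y ∧ IsBranchPoint n 0 ω y := by
  set N : Set Site := {y | y ∈ openSites ω \ box n 0 ∧ (∃ b ∈ box n 0, Adj b y) ∧
    Conn (openSites ω) x y} with hN
  have hNfin : N.Finite := by
    refine (finite_supNorm_le (n + 1)).subset ?_
    rintro y ⟨-, ⟨b, hb, hadj⟩, -⟩
    have h1 := mem_box_zero.1 hb
    have h2 := hadj.supNorm_le
    show supNorm y ≤ n + 1
    omega
  have hcov : component (openSites ω) x ⊆
      box n 0 ∪ ⋃ y ∈ N, component (openSites ω \ box n 0) y := by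
    intro z hz
    have hz' : Conn (openSites ω) x z := hz
    induction hz' using Conn.induction with
    | hx h => exact Or.inl hx
    | hstep b c h hbc hc ih =>
      by_cases hcB : c ∈ box n 0
      · exact Or.inl hcB
      · right
        rcases ih h with hb | hb
        · refine Set.mem_biUnion (x := c) ⟨⟨hc, hcB⟩, ⟨b, hb, hbc⟩, h.step hbc hc⟩ ?_
          exact Conn.refl ⟨hc, hcB⟩
        · obtain ⟨y, hy, hyb⟩ := Set.mem_iUnion₂.1 hb
          exact Set.mem_biUnion hy (Conn.step hyb hbc ⟨hc, hcB⟩)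
  by_contra! hcon
  refine hinf (((finite_box_zero n).union (hNfin.biUnion fun y hy => ?_)).subset hcov)
  by_contra hyinf
  exact hcon y hy.2.2 ⟨hy.1, hy.2.1, hyinf⟩

theorem isTrifurcation_openUp {n : ℕ} {ω : Config} (h : ThreeInfiniteMeet n ω) :
    IsTrifurcation n 0 (openUp (box n 0) ω) := by
  obtain ⟨x, hx, y, hy, z, hz, ix, iy, iz, hxy, hxz, hyz⟩ := h
  obtain ⟨x', hx', bx⟩ := exists_isBranchPoint hx ix
  obtain ⟨y', hy', bY⟩ := exists_isBranchPoint hy iy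
  obtain ⟨z', hz', bz⟩ := exists_isBranchPoint hz iz
  have hb : ∀ w, IsBranchPoint n 0 ω w → IsBranchPoint n 0 (openUp (box n 0) ω) w := by
    intro w hw
    rwa [IsBranchPoint, openSites_openUp_diff]
  refine ⟨by rw [openSites_openUp]; exact Set.subset_union_right, x', y', z', hb _ bx, hb _ bY,
    hb _ bz, ?_⟩
  rw [openSites_openUp_diff]
  have hc : ∀ {u v u' v'}, Conn (openSites ω) u u' → Conn (openSites ω) v v' →
      ¬ Conn (openSites ω) u v → ¬ Conn (openSites ω \ box n 0) u' v' := by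
    intro u v u' v' hu hv huv h
    exact huv ((hu.trans (h.mono Set.sdiff_subset)).trans hv.symm)
  exact ⟨hc hx' hy' hxy, hc hx' hz' hxz, hc hy' hz' hyz⟩

/-- Opening the sites of a finite set does not make a null event likely. -/
theorem measure_openUp_preimage_eq_zero {p : unitInterval} (hp : 0 < (p : ℝ)) {B : Set Site}
    (hB : B.Finite) {G : Set Config} (hG : MeasurableSet G) (h0 : law p G = 0) :
    law p (openUp B ⁻¹' G) = 0 := by
  set m : Site → MeasurableSpace Config :=
    fun u => MeasurableSpace.comap (fun ω : Config => ω u) inferInstance with hm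
  -- The preimage depends only on sites outside `B`, hence is independent of the event `O` that `B`
  -- is open. On `O` opening changes nothing, so the intersection lies in `G`; as `O` has positive
  -- probability, the preimage is null.
  have hind : Indep (⨆ u ∈ B, m u) (⨆ u ∈ Bᶜ, m u) (law p) :=
    indep_iSup_of_disjoint (fun u => (measurable_pi_apply u).comap_le) (iIndepFun_eval_law p)
      disjoint_compl_right
  set O : Set Config := {ω | ∀ u ∈ B, ω u = true} with hO
  have hOm : MeasurableSet[⨆ u ∈ B, m u] O := by
    have : O = ⋂ u ∈ B, {ω | ω u = true} := by ext; simp [hO]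
    rw [this]
    refine MeasurableSet.biInter (Set.to_countable B) fun u hu => ?_
    exact (le_iSup₂ (f := fun u (_ : u ∈ B) => m u) u hu) _
      ⟨{true}, measurableSet_singleton true, rfl⟩
  have hHm : MeasurableSet[⨆ u ∈ Bᶜ, m u] (openUp B ⁻¹' G) := by
    have : Measurable[⨆ u ∈ Bᶜ, m u] (openUp B) := by
      refine @measurable_pi_lambda _ _ _ (⨆ u ∈ Bᶜ, m u) _ _ fun u => ?_
      by_cases hu : u ∈ B
      · simp only [openUp, hu, if_true]
        exact measurable_const
      · simp only [openUp, hu, if_false]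
        exact measurable_iff_comap_le.2 (le_iSup₂ (f := fun u (_ : u ∈ Bᶜ) => m u) u hu)
    exact this hG
  have hprod : law p (O ∩ openUp B ⁻¹' G) = law p O * law p (openUp B ⁻¹' G) :=
    (Indep_iff _ _ _).1 hind O _ hOm hHm
  have hzero : law p (O ∩ openUp B ⁻¹' G) = 0 := by
    refine measure_mono_null ?_ h0
    rintro ω ⟨hω, hωG⟩
    have : openUp B ω = ω := by
      funext u
      by_cases hu : u ∈ B
      · simp [openUp, hu, hω u hu]
      · simp [openUp, hu]
    rwa [Set.mem_preimage, this] at hωG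
  have hOpos : law p O ≠ 0 := by
    have : O = (hB.toFinset : Set Site).pi fun _ => {true} := by
      ext ω; simp [hO, Set.mem_pi]
    rw [this, law, Measure.infinitePi_pi _ fun _ _ => measurableSet_singleton true]
    refine Finset.prod_ne_zero_iff.2 fun u _ => ?_
    rw [bernoulliMeasure_apply_of_mem_of_notMem p (measurableSet_singleton true) (by simp)
      (by simp)]
    rw [Ne, ENNReal.coe_eq_zero, ← NNReal.coe_eq_zero]
    exact hp.ne'
  rw [hprod] at hzero
  exact (mul_eq_zero.1 hzero).resolve_left hOpos

theorem measure_threeInfiniteMeet {p : unitInterval} (hp : 0 < (p : ℝ)) (n : ℕ) :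
    law p {ω | ThreeInfiniteMeet n ω} = 0 := by
  have h0 : law p {ω | IsTrifurcation n 0 ω} = 0 :=
    (measureReal_eq_zero_iff).1 (measure_isTrifurcation_zero p n)
  exact measure_mono_null (fun ω hω => isTrifurcation_openUp hω)
    (measure_openUp_preimage_eq_zero hp (finite_box_zero n)
      (measurableSet_setOfPred.2 (measurable_isTrifurcation n 0)) h0)

theorem ae_of_invariant {p : unitInterval} {P : Config → Prop} (hP : Measurable P)
    (hinv : ∀ ω, P (shift (1, 0) ω) ↔ P ω) (h : ¬ ∀ᵐ ω ∂law p, ¬ P ω) : ∀ᵐ ω ∂law p, P ω :=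
  ((ergodic_shift p (z := (1, 0)) (by simp)).toPreErgodic.ae_mem_or_ae_notMem
    (measurableSet_setOfPred.2 hP) (Set.ext hinv)).resolve_right h

theorem exists_add_iff {P : Site → Prop} (z : Site) : (∃ x, P (x + z)) ↔ ∃ x, P x :=
  ⟨fun ⟨x, hx⟩ => ⟨_, hx⟩, fun ⟨x, hx⟩ => ⟨x - z, by simpa using hx⟩⟩

theorem atMostOneInfinite_shift (z : Site) (ω : Config) :
    AtMostOneInfinite (shift z ω) ↔ AtMostOneInfinite ω := by
  simp only [AtMostOneInfinite, inInfinite_shift, conn_shift]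
  refine ⟨fun h x y => ?_, fun h x y => h _ _⟩
  simpa using h (x - z) (y - z)

/-- By the zero-one law, failure would be almost sure. Then no box meets all infinite clusters,
since opening it would restore uniqueness; but no box meets three of them either, contradicting
`exists_allInfiniteMeet`. -/
theorem ae_atMostOneInfinite {p : unitInterval} (hp : 0 < (p : ℝ)) :
    ∀ᵐ ω ∂law p, AtMostOneInfinite ω := by
  refine ae_of_invariant measurable_atMostOneInfinite (fun ω => atMostOneInfinite_shift _ ω) ?_
  intro hnone
  have h1 : ∀ᵐ ω ∂law p, ∀ n, ¬ ThreeInfiniteMeet n ω :=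
    ae_all_iff.2 fun n => by
      rw [ae_iff]
      simpa only [not_not] using measure_threeInfiniteMeet hp n
  have h2 : ∀ᵐ ω ∂law p, ∀ n, ¬ AllInfiniteMeet n ω := by
    refine ae_all_iff.2 fun n => ?_
    rw [ae_iff] at hnone ⊢
    simp only [not_not] at hnone ⊢
    exact measure_mono_null (fun ω hω => atMostOneInfinite_openUp hω)
      (measure_openUp_preimage_eq_zero hp (finite_box_zero n)
        (measurableSet_setOfPred.2 measurable_atMostOneInfinite) hnone)
  obtain ⟨ω, hω1, hω2⟩ := (h1.and h2).exists
  obtain ⟨n, hn⟩ := exists_allInfiniteMeet hω1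
  exact hω2 n hn

/-! ### Infinite open and extended clusters -/

theorem isIOC_iff {ω : Config} {C : Set Site} :
    IsIOC ω C ↔ ∃ u, InInfinite ω u ∧ C = component (openSites ω) u := by
  constructor
  · rintro ⟨hinf, u, rfl⟩
    rw [cluster_eq_component] at hinf ⊢
    exact ⟨u, hinf, rfl⟩
  · rintro ⟨u, hu, rfl⟩
    exact ⟨hu, u, (cluster_eq_component ω u).symm⟩

theorem exists_isIOC_iff {ω : Config} : (∃ C, IsIOC ω C) ↔ ∃ x, InInfinite ω x := by
  simp only [isIOC_iff]
  exact ⟨fun ⟨_, u, hu, _⟩ => ⟨u, hu⟩, fun ⟨u, hu⟩ => ⟨_, u, hu, rfl⟩⟩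

theorem exists_isIOC_mem_iff {ω : Config} {u : Site} :
    (∃ C, IsIOC ω C ∧ u ∈ C) ↔ InInfinite ω u := by
  simp only [isIOC_iff]
  constructor
  · rintro ⟨_, ⟨x, hx, rfl⟩, hu⟩
    exact hx.of_conn hu
  · intro hu
    exact ⟨_, ⟨u, hu, rfl⟩, Conn.refl hu.mem_openSites⟩

theorem finite_boundary {ω : Config} {S : Set Site} (hS : S.Finite) : (boundary ω S).Finite := by
  refine (hS.biUnion fun w _ => finite_supNorm_le (supNorm w + 1)).subset ?_
  rintro v ⟨-, w, hw, hvw⟩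
  exact Set.mem_biUnion hw hvw.symm.supNorm_le

/-- A finite cluster has a finite boundary, so the extended cluster is infinite only if the cluster
is. -/
theorem isIEC_iff {ω : Config} {C : Set Site} : IsIEC ω C ↔
    ∃ u, InInfinite ω u ∧
      C = component (openSites ω) u ∪ boundary ω (component (openSites ω) u) := by
  constructor
  · rintro ⟨hinf, u, rfl⟩
    rw [extCluster, cluster_eq_component] at hinf ⊢
    refine ⟨u, fun hfin => hinf (hfin.union (finite_boundary hfin)), rfl⟩
  · rintro ⟨u, hu, rfl⟩
    exact ⟨hu.mono Set.subset_union_left, u, by rw [extCluster, cluster_eq_component]⟩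

/-- `u` lies in an infinite open cluster or in the boundary of one. -/
def InInfiniteExt (ω : Config) (u : Site) : Prop :=
  InInfinite ω u ∨ ¬ ω u = true ∧ ∃ w, Adj u w ∧ InInfinite ω w

theorem measurable_inInfiniteExt (u : Site) : Measurable fun ω => InInfiniteExt ω u :=
  (measurable_inInfinite u).or ((measurable_apply u).not.and
    (Measurable.exists fun w => measurable_const.and (measurable_inInfinite w)))

theorem exists_isIEC_mem_iff {ω : Config} {u : Site} :
    (∃ C, IsIEC ω C ∧ u ∈ C) ↔ InInfiniteExt ω u := by
  simp only [isIEC_iff]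
  constructor
  · rintro ⟨_, ⟨x, hx, rfl⟩, hu | ⟨hu, w, hw, huw⟩⟩
    · exact Or.inl (hx.of_conn hu)
    · exact Or.inr ⟨by simp [hu], w, huw, hx.of_conn hw⟩
  · rintro (hu | ⟨hu, w, huw, hw⟩)
    · exact ⟨_, ⟨u, hu, rfl⟩, Or.inl (Conn.refl hu.mem_openSites)⟩
    · exact ⟨_, ⟨w, hw, rfl⟩, Or.inr ⟨by simpa using hu, w, Conn.refl hw.mem_openSites, huw⟩⟩

theorem inInfiniteExt_shift {c u : Site} {ω : Config} :
    InInfiniteExt (shift c ω) u ↔ InInfiniteExt ω (u + c) := by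
  have h : (∃ w, Adj u w ∧ InInfinite ω (w + c)) ↔ ∃ w, Adj (u + c) w ∧ InInfinite ω w := by
    rw [← exists_add_iff (P := fun w => Adj (u + c) w ∧ InInfinite ω w) c]
    simp [Adj]
  simp only [InInfiniteExt, inInfinite_shift, h]
  rfl

/-! ### Densities and conclusion -/

theorem grid_eq (k : ℕ) : grid (2 * k + 1) =
    ((Finset.Icc (-k : ℤ) k ×ˢ Finset.Icc (-k : ℤ) k : Finset Site) : Set Site) := by
  have hk : (((2 * k + 1 : ℕ) : ℝ) - 1) / 2 = k := by push_cast; ring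
  have key : ∀ a : ℤ, |(a : ℝ)| ≤ (k : ℝ) ↔ -(k : ℤ) ≤ a ∧ a ≤ k := by
    intro a
    rw [abs_le]
    exact_mod_cast Iff.rfl
  ext u
  simp only [grid, hk, Set.mem_ofPred_eq, key, Finset.coe_product, Finset.coe_Icc, Set.mem_prod,
    Set.mem_Icc]

/-- The density of the sites with a translation invariant property. -/
theorem ae_tendsto_density (p : unitInterval) {P : Config → Site → Prop}
    (hP : Measurable fun ω => P ω 0) (hshift : ∀ u ω, P (shift u ω) 0 ↔ P ω u) :
    ∀ᵐ ω ∂law p, ∀ C : Set Site, (∀ u, u ∈ C ↔ P ω u) →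
      Tendsto (fun m : ℕ => ((C ∩ grid m).ncard : ℝ) / (m : ℝ) ^ 2)
        (atTop ⊓ 𝓟 {m : ℕ | Odd m}) (𝓝 ((law p).real {ω | P ω 0})) := by
  classical
  have hPm : MeasurableSet {ω | P ω 0} := measurableSet_setOfPred.2 hP
  have hlim := ae_tendsto_squareAverage p (f := {ω | P ω 0}.indicator fun _ => (1 : ℝ))
    (measurable_const.indicator hPm) (fun ω => by
      by_cases h : ω ∈ {ω | P ω 0}
      · rw [Set.indicator_of_mem h]; simp
      · rw [Set.indicator_of_notMem h]; simp)
  have hint : ∫ ω, {ω | P ω 0}.indicator (fun _ => (1 : ℝ)) ω ∂law p =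
      (law p).real {ω | P ω 0} := integral_indicator_one hPm
  rw [hint] at hlim
  filter_upwards [hlim] with ω hω C hC
  -- For odd `m = 2 * k + 1` the truncated quotient `m / 2` is the radius `k` of the grid.
  have h2 : Tendsto (fun m : ℕ => m / 2) atTop atTop := Nat.tendsto_div_const_atTop two_ne_zero
  refine Tendsto.congr' ?_ ((hω.comp h2).mono_left inf_le_left)
  filter_upwards [mem_inf_of_right (mem_principal_self {m : ℕ | Odd m})] with m hm
  obtain ⟨k, rfl⟩ := hm
  have hk : (2 * k + 1) / 2 = k := by omega
  rw [Function.comp_apply, hk, squareAverage_eq_sum, grid_eq]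
  have hset : C ∩ ((Finset.Icc (-k : ℤ) k ×ˢ Finset.Icc (-k : ℤ) k : Finset Site) : Set Site) =
      (((Finset.Icc (-k : ℤ) k ×ˢ Finset.Icc (-k : ℤ) k : Finset Site).filter
        fun u => P ω u : Finset Site) : Set Site) := by
    ext u
    rw [Set.mem_inter_iff, hC, Finset.mem_coe, Finset.mem_coe, Finset.mem_filter, and_comm]
  rw [hset, Set.ncard_coe_finset, Finset.card_filter]
  push_cast
  congr 1
  refine Finset.sum_congr rfl fun u _ => ?_
  simp [Set.indicator_apply, hshift]

theorem ae_exists_inInfinite {p : unitInterval} (hp : pc < (p : ℝ)) :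
    ∀ᵐ ω ∂law p, ∃ x, InInfinite ω x := by
  refine ae_of_invariant (Measurable.exists fun x => measurable_inInfinite x) (fun ω => ?_) ?_
  · simp only [inInfinite_shift]
    exact exists_add_iff (P := fun x => InInfinite ω x) _
  · intro h
    refine not_le.2 hp (le_csSup ⟨1, ?_⟩ (Set.mem_image_of_mem _ ?_))
    · rintro _ ⟨q, -, rfl⟩
      exact q.2.2
    · show ∀ᵐ ω ∂law p, ¬ ∃ C, IsIOC ω C
      simpa only [exists_isIOC_iff] using h

/-- Supplies `0 < p`, without which opening a box has probability zero. -/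
theorem pc_nonneg : 0 ≤ pc := Real.sSup_nonneg (by rintro _ ⟨q, -, rfl⟩; exact q.2.1)

theorem existsUnique_isIOC {ω : Config} (h : ∃ x, InInfinite ω x) (h1 : AtMostOneInfinite ω) :
    ∃! C, IsIOC ω C := by
  obtain ⟨x, hx⟩ := h
  refine ⟨_, isIOC_iff.2 ⟨x, hx, rfl⟩, fun C hC => ?_⟩
  obtain ⟨u, hu, rfl⟩ := isIOC_iff.1 hC
  exact component_eq (h1 u x hu hx)

theorem existsUnique_isIEC {ω : Config} (h : ∃ x, InInfinite ω x) (h1 : AtMostOneInfinite ω) :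
    ∃! C, IsIEC ω C := by
  obtain ⟨x, hx⟩ := h
  refine ⟨_, isIEC_iff.2 ⟨x, hx, rfl⟩, fun C hC => ?_⟩
  obtain ⟨u, hu, rfl⟩ := isIEC_iff.1 hC
  rw [component_eq (h1 u x hu hx)]

theorem IsProcess.map_eq_law {Ω : Type*} [MeasurableSpace Ω] {μ : Measure Ω}
    {p : unitInterval} {X : Site → Ω → Bool} (hX : IsProcess μ p X) :
    μ.map (fun x u => X u x) = law p := by
  rw [hX.indep.map_fun_eq_infinitePi_map hX.measurable, law]
  simp only [hX.map_eq]

/-- Turns membership in the unique cluster into a property of the site alone, to which the density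
theorem applies. -/
theorem mem_iff_of_existsUnique {Q : Set Site → Prop} (h : ∃! C, Q C) {C : Set Site} (hC : Q C)
    (u : Site) : u ∈ C ↔ ∃ C, Q C ∧ u ∈ C :=
  ⟨fun hu => ⟨C, hC, hu⟩, fun ⟨_, hD, hu⟩ => h.unique hD hC ▸ hu⟩

theorem ae_law_unique_and_density {p : unitInterval} (hp : pc < (p : ℝ)) :
    ∀ᵐ ω ∂law p, (∃! C, IsIOC ω C) ∧ (∃! C', IsIEC ω C') ∧
      (∀ C, IsIOC ω C →
        Tendsto (fun m : ℕ => ((C ∩ grid m).ncard : ℝ) / (m : ℝ) ^ 2)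
          (atTop ⊓ 𝓟 {m : ℕ | Odd m}) (𝓝 (theta p))) ∧
      (∀ C', IsIEC ω C' →
        Tendsto (fun m : ℕ => ((C' ∩ grid m).ncard : ℝ) / (m : ℝ) ^ 2)
          (atTop ⊓ 𝓟 {m : ℕ | Odd m}) (𝓝 (thetaPlus p))) := by
  filter_upwards [ae_exists_inInfinite hp, ae_atMostOneInfinite (pc_nonneg.trans_lt hp),
    ae_tendsto_density p (P := InInfinite) (measurable_inInfinite 0)
      (fun u ω => by rw [inInfinite_shift, zero_add]),
    ae_tendsto_density p (P := InInfiniteExt) (measurable_inInfiniteExt 0)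
      (fun u ω => by rw [inInfiniteExt_shift, zero_add])] with ω h h1 hd hd'
  have hu := existsUnique_isIOC h h1
  have hu' := existsUnique_isIEC h h1
  refine ⟨hu, hu', fun C hC => ?_, fun C hC => ?_⟩
  · simp only [theta, exists_isIOC_mem_iff]
    exact hd C fun u => (mem_iff_of_existsUnique hu hC u).trans exists_isIOC_mem_iff
  · simp only [thetaPlus, exists_isIEC_mem_iff]
    exact hd' C fun u => (mem_iff_of_existsUnique hu' hC u).trans exists_isIEC_mem_iff

end SitePercolation

theorem mainTheorem8 {Ω : Type*} [MeasurableSpace Ω] (μ : Measure Ω) [IsProbabilityMeasure μ]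
    (p : unitInterval) (hp : SitePercolation.pc < (p : ℝ))
    (X : SitePercolation.Site → Ω → Bool) (hX : SitePercolation.IsProcess μ p X) :
    ∀ᵐ x ∂μ,
      (∃! C, SitePercolation.IsIOC (fun u => X u x) C) ∧
      (∃! C', SitePercolation.IsIEC (fun u => X u x) C') ∧
      (∀ C, SitePercolation.IsIOC (fun u => X u x) C →
        Tendsto (fun m : ℕ => ((C ∩ SitePercolation.grid m).ncard : ℝ) / (m : ℝ) ^ 2)
          (atTop ⊓ 𝓟 {m : ℕ | Odd m}) (𝓝 (SitePercolation.theta p))) ∧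
      (∀ C', SitePercolation.IsIEC (fun u => X u x) C' →
        Tendsto (fun m : ℕ => ((C' ∩ SitePercolation.grid m).ncard : ℝ) / (m : ℝ) ^ 2)
          (atTop ⊓ 𝓟 {m : ℕ | Odd m}) (𝓝 (SitePercolation.thetaPlus p))) := by
  have hm : AEMeasurable (fun x u => X u x) μ :=
    (measurable_pi_lambda _ fun u => hX.measurable u).aemeasurable
  have h := SitePercolation.ae_law_unique_and_density hp
  rw [← hX.map_eq_law] at h
  exact ae_of_ae_map hm h
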